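/- Let $\mathbb D$ be the open unit disc of $\mathbb C$ and $dA=\frac{dx\,dy}{\pi}$. A radial weight is an integrable function $v:\mathbb D\to(0,\infty)$ with $v(z)=v(|z|)$; put $\widehat v(r)=\int_r^1 v(s)\,ds$. The weight belongs to $\widehat{\mathcal D}$ if its doubling constant $K(v)=\sup_{0<r<1}\widehat v(r)/\widehat v(\tfrac{1+r}{2})$ is finite. Let $\mathcal D_v$ be the space of analytic functions $f$ on $\mathbb D$ with $\|f\|_{\mathcal D_v}^2=|f(0)|^2+\int_{\mathbb D}|f'|^2v\,dA<\infty$, and let $L^2_{\widehat V_2}$ be the space of measurable $\varphi:[0,1)\to\mathbb C$ with $\|\varphi\|^2=\int_0^1|\varphi(s)|^2\frac{\widehat v(s)}{(1-s)^2}\,ds<\infty$. For such $\varphi$ and $z\in\mathbb D$ put $$\mathcal H(\varphi)(z)=\int_0^1\frac{\varphi(t)}{1-tz}\,dt,\qquad \widetilde{\mathcal H}(\varphi)(z)=\int_0^1\frac{|\varphi(t)|}{1-tz}\,dt,$$ and let $$M_1(v)=\sup_{0<r<1}\Big(\int_r^1\frac{\widehat v(s)}{(1-s)^2}ds\Big)^{1/2}\Big(\int_0^r\frac{ds}{\widehat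 v(s)}\Big)^{1/2},\quad M_2(v)=\sup_{0<r<1}\Big(\int_0^r\frac{\widehat v(s)}{(1-s)^4}ds\Big)^{1/2}\Big(\int_r^1\frac{(1-s)^2}{\widehat v(s)}ds\Big)^{1/2}.$$ **Theorem.** Let $v\in\widehat{\mathcal D}$ satisfy $\int_0^1\frac{(1-s)^2}{\widehat v(s)}\,ds<\infty$ and $M_1(v)<\infty$. Then the following are equivalent: (i) $\mathcal H:L^2_{\widehat V_2}\to\mathcal D_v$ is bounded; (ii) $\widetilde{\mathcal H}:L^2_{\widehat V_2}\to\mathcal D_v$ is bounded; (iii) $M_2(v)<\infty$. Moreover, if $M_2(v)<\infty$, then, with operator norms from $L^2_{\widehat V_2}$ to $\mathcal D_v$, $$\frac{M_2(v)}{M_1(v)}\lesssim\|\mathcal H\|\asymp\|\widetilde{\mathcal H}\|\lesssim M_1(v)\,M_2(v),$$ where the constants in the first inequality and in $\asymp$ are absolute, and the constant in the last inequality depends only on upper bounds for $K(v)$ and positive lower bounds for $\widehat v(0)$ (in particular, only on $v$). -/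

import Mathlib

open MeasureTheory Set
open scoped ENNReal NNReal

namespace WeightedDirichlet

noncomputable section

/-- A radial weight on the unit disc: a positive integrable function on the disc
depending only on the modulus. -/
structure IsRadialWeight (v : ℂ → ℝ) : Prop where
  pos : ∀ z ∈ Metric.ball (0 : ℂ) 1, 0 < v z
  integrable : IntegrableOn v (Metric.ball (0 : ℂ) 1)
  radial : ∀ z ∈ Metric.ball (0 : ℂ) 1, v z = v (‖z‖ : ℂ)

/-- The tail integral `v̂(r) = ∫_r^1 v(s) ds`. -/
def vhat (v : ℂ → ℝ) (r : ℝ) : ℝ≥0∞ :=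
  ∫⁻ s in Ioo r 1, ENNReal.ofReal (v (s : ℂ))

/-- `K` bounds the doubling quotient: `v̂(r) ≤ K v̂((1+r)/2)` for `0 < r < 1`. -/
def DoublingWith (v : ℂ → ℝ) (K : ℝ≥0) : Prop :=
  ∀ r ∈ Ioo (0 : ℝ) 1, vhat v r ≤ K * vhat v ((1 + r) / 2)

/-- The class `𝒟̂` of doubling radial weights. -/
def MemDHat (v : ℂ → ℝ) : Prop :=
  IsRadialWeight v ∧ ∃ K : ℝ≥0, DoublingWith v K

/-- `V̂_x(r) = v̂(r) / (1 - r)^x`. -/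
def Vhat (v : ℂ → ℝ) (x r : ℝ) : ℝ≥0∞ :=
  vhat v r / ENNReal.ofReal (1 - r) ^ x

/-- The condition `∫_0^1 (1 - s)² / v̂(s) ds < ∞`. -/
def IntegrabilityCondition (v : ℂ → ℝ) : Prop :=
  ∫⁻ s in Ioo (0 : ℝ) 1, ENNReal.ofReal (1 - s) ^ 2 / vhat v s < ∞

/-- The Muckenhoupt-type quantity `M₁(v)`, possibly infinite. -/
def M₁ (v : ℂ → ℝ) : ℝ≥0∞ :=
  ⨆ r ∈ Ioo (0 : ℝ) 1,
    (∫⁻ s in Ioo r 1, vhat v s / ENNReal.ofReal (1 - s) ^ 2) ^ (1 / 2 : ℝ) *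
      (∫⁻ s in Ioo 0 r, 1 / vhat v s) ^ (1 / 2 : ℝ)

/-- The Muckenhoupt-type quantity `M₂(v)`, possibly infinite. -/
def M₂ (v : ℂ → ℝ) : ℝ≥0∞ :=
  ⨆ r ∈ Ioo (0 : ℝ) 1,
    (∫⁻ s in Ioo 0 r, vhat v s / ENNReal.ofReal (1 - s) ^ 4) ^ (1 / 2 : ℝ) *
      (∫⁻ s in Ioo r 1, ENNReal.ofReal (1 - s) ^ 2 / vhat v s) ^ (1 / 2 : ℝ)

/-- The measure `V̂₂(s) ds` on `(0, 1)`; `L²_{V̂₂}` is the complex `L²` space of it. -/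
def measV2 (v : ℂ → ℝ) : Measure ℝ :=
  (volume.restrict (Ioo (0 : ℝ) 1)).withDensity (Vhat v 2)

/-- The norm of the weighted Dirichlet space,
`(|f(0)|² + ∫_𝔻 |f'|² v dA)^{1/2}` with `dA = dx dy / π`; possibly infinite. -/
def dirichletNorm (v : ℂ → ℝ) (f : ℂ → ℂ) : ℝ≥0∞ :=
  (‖f 0‖ₑ ^ 2 + (∫⁻ z in Metric.ball (0 : ℂ) 1, ‖deriv f z‖ₑ ^ 2 * ENNReal.ofReal (v z)) /
    ENNReal.ofReal Real.pi) ^ (1 / 2 : ℝ)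

/-- Membership in the weighted Dirichlet space `𝒟_v`. -/
def MemDirichlet (v : ℂ → ℝ) (f : ℂ → ℂ) : Prop :=
  DifferentiableOn ℂ f (Metric.ball (0 : ℂ) 1) ∧ dirichletNorm v f < ∞

/-- The Hilbert operator `H(φ)(z) = ∫_0^1 φ(t) / (1 - t z) dt`. -/
def hilbertOp (φ : ℝ → ℂ) (z : ℂ) : ℂ :=
  ∫ t in Ioo (0 : ℝ) 1, φ t / (1 - (t : ℂ) * z)

/-- The sublinear Hilbert operator `H̃(φ)(z) = ∫_0^1 |φ(t)| / (1 - t z) dt`. -/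
def sublinearHilbertOp (φ : ℝ → ℂ) (z : ℂ) : ℂ :=
  ∫ t in Ioo (0 : ℝ) 1, (‖φ t‖ : ℂ) / (1 - (t : ℂ) * z)

/-- `T` maps `L²_{V̂₂}` into `𝒟_v` with `‖T φ‖ ≤ C ‖φ‖`. -/
def BoundedWith (v : ℂ → ℝ) (T : (ℝ → ℂ) → ℂ → ℂ) (C : ℝ≥0) : Prop :=
  ∀ φ : ℝ → ℂ, MemLp φ 2 (measV2 v) →
    MemDirichlet v (T φ) ∧ dirichletNorm v (T φ) ≤ C * eLpNorm φ 2 (measV2 v)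

/-- `T : L²_{V̂₂} → 𝒟_v` is bounded. -/
def IsBoundedOp (v : ℂ → ℝ) (T : (ℝ → ℂ) → ℂ → ℂ) : Prop :=
  ∃ C : ℝ≥0, BoundedWith v T C

/-- The norm of `T : L²_{V̂₂} → 𝒟_v`, i.e. the best bound (`∞` if `T` is unbounded). -/
def opNorm (v : ℂ → ℝ) (T : (ℝ → ℂ) → ℂ → ℂ) : ℝ≥0∞ :=
  ⨅ (C : ℝ≥0) (_ : BoundedWith v T C), (C : ℝ≥0∞)

end

end WeightedDirichlet

/-!
The proof turns the area integral in the Dirichlet norm into a one-dimensional weighted problem, to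
which Hardy's inequality applies.

The Taylor coefficients of `hilbertOp φ` are the moments `∫ φ(t) tⁿ dt`. Parseval's identity on
circles and polar coordinates give
`‖H φ‖² = |φ_0|² + 2 ∫_0^1 r v(r) ∑ (n + 1)² |φ_{n+1}|² r^{2n} dr`
(`dirichletNorm_hilbertOp`), where `φ_n` is the `n`-th moment. As `|φ_n|` is at most the `n`-th
moment of `|φ|`, the norm of `H φ` is at most the norm of `H |φ|`, which is the sublinear operator
applied to `φ`. Hence the two operators have the same bounds (`boundedWith_sublinear_iff`).

*Upper bound.* For a nonnegative symbol with `F(ρ) = ∫ t φ(t) / (1 - t ρ)² dt`, squaring out the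
moments and summing the series under the integral sign leads to the kernel `(1 - t s r²)⁻³`. It is
at most `1 + 6 ∫_0^r (1 - t ρ)⁻² (1 - s ρ)⁻² dρ`, so that the mean of `|(H φ)'|²` on the circle of
radius `r` is at most `2 F(0)² + 12 ∫_0^r F²` (`tsum_sq_moment_le`). Integration against `v`
produces `∫ F² v̂`, where doubling absorbs the term `F(0)²`. Splitting `F(ρ)` at `t = ρ` leaves two
Hardy operators, whose Muckenhoupt constants are at most `M₁` and `M₂`. Hardy's inequality is proved
for two measures on the line (`hardy_Iio`, `hardy_Ioi`) by Cauchy–Schwarz with a power of the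
distribution function as weight. The resulting bound `M₁² + M₂²` is of the order `M₁² M₂²`, since
both quantities are bounded below by absolute constants: `M₂` by monotonicity of `v̂`
(`one_le_sq_M₂`), `M₁` because a small `M₁` forces `v̂` to decay so fast that `(1 - s)² / v̂(s)` is
not integrable (`one_le_sq_M₁`).

*Lower bound.* The symbol `(1 - s)² / v̂(s)` cut off to `(r, 1)` has moments at least `rⁿ` times its
mass, which yields `r² ∫_r^1 (1 - s)² / v̂ · ∫_0^1 v̂(x) / (1 - r² x²)⁴ dx ≲ ‖H‖²`
(`le_sq_of_boundedWith`). This is the required estimate of `M₂` for `r ≥ 1 / 2`. For `r < 1 / 2` the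
dual mass of `(r, 1 / 2)` is estimated with `M₁` at `1 / 2` and Cauchy–Schwarz on `(1 / 2, 1)`
(`M₂_le_of_boundedWith`).
-/

namespace WeightedDirichlet

noncomputable section

/-! ### Hardy inequalities with two measures -/

/-- In the absence of atoms, a set all of whose initial segments have measure at most `c` has
measure at most `c`: it is, up to one point, a countable directed union of such segments. -/
lemma measure_le_of_forall_inter_Iio {α : Type*} [LinearOrder α] [TopologicalSpace α]
    [OrderTopology α] [SecondCountableTopology α] [MeasurableSpace α] (μ : Measure α)
    [NullSingletonClass μ] {S : Set α} {c : ℝ≥0∞} (h : ∀ t ∈ S, μ (S ∩ Iio t) ≤ c) : μ S ≤ c := by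
  obtain ⟨T, hTS, hT, hU⟩ := TopologicalSpace.isOpen_biUnion_countable S (fun t ↦ Iio t)
    (fun t _ ↦ isOpen_Iio)
  have hsub : (S \ ⋃ t ∈ S, Iio t).Subsingleton := by
    rintro a ⟨ha, ha'⟩ b ⟨hb, hb'⟩
    simp only [mem_iUnion, mem_Iio, not_exists, not_lt] at ha' hb'
    exact le_antisymm (hb' a ha) (ha' b hb)
  have hS : S ⊆ (⋃ t ∈ T, (S ∩ Iio t)) ∪ (S \ ⋃ t ∈ S, Iio t) := by
    intro x hx
    by_cases hxU : x ∈ ⋃ t ∈ S, Iio t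
    · left
      rw [← hU] at hxU
      simp only [mem_iUnion] at hxU ⊢
      obtain ⟨t, ht, hxt⟩ := hxU
      exact ⟨t, ht, hx, hxt⟩
    · exact Or.inr ⟨hx, hxU⟩
  have hdir : DirectedOn (Function.onFun (· ⊆ ·) fun t ↦ S ∩ Iio t) T := by
    intro a ha b hb
    rcases le_total a b with hab | hab
    · exact ⟨b, hb, inter_subset_inter_right _ (Iio_subset_Iio hab), subset_rfl⟩
    · exact ⟨a, ha, subset_rfl, inter_subset_inter_right _ (Iio_subset_Iio hab)⟩
  calc μ S ≤ μ (⋃ t ∈ T, (S ∩ Iio t)) + μ (S \ ⋃ t ∈ S, Iio t) :=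
        (measure_mono hS).trans (measure_union_le _ _)
    _ = ⨆ t ∈ T, μ (S ∩ Iio t) := by
        rw [hsub.measure_zero, add_zero, measure_biUnion_eq_iSup hT hdir]
    _ ≤ c := iSup₂_le fun t ht ↦ h t (hTS ht)

lemma measure_le_of_forall_inter_Ioi {α : Type*} [LinearOrder α] [TopologicalSpace α]
    [OrderTopology α] [SecondCountableTopology α] [hα : MeasurableSpace α] (μ : Measure α)
    [hμ : NullSingletonClass μ] {S : Set α} {c : ℝ≥0∞} (h : ∀ t ∈ S, μ (S ∩ Ioi t) ≤ c) : μ S ≤ c :=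
  @measure_le_of_forall_inter_Iio αᵒᵈ _ _ _ _ hα μ hμ S c h

lemma lintegral_Ioi_rpow {x : ℝ} (hx : 0 < x) :
    ∫⁻ l in Ioi x, ENNReal.ofReal (1 / 2 * l ^ (-(3 / 2) : ℝ)) =
      ENNReal.ofReal (x ^ (-(1 / 2) : ℝ)) := by
  rw [← ofReal_integral_eq_lintegral_ofReal]
  · rw [integral_const_mul, integral_Ioi_rpow_of_lt (by norm_num) hx]
    congr 1
    norm_num
    ring
  · exact (integrableOn_Ioi_rpow_of_lt (by norm_num) hx).const_mul _
  · filter_upwards [self_mem_ae_restrict measurableSet_Ioi] with l hl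
    have : 0 < l := hx.trans hl
    positivity

lemma lintegral_Ioc_rpow {x : ℝ} (hx : 0 < x) :
    ∫⁻ l in Ioc 0 x, ENNReal.ofReal (1 / 2 * l ^ (-(1 / 2) : ℝ)) =
      ENNReal.ofReal (x ^ (1 / 2 : ℝ)) := by
  have hi : IntervalIntegrable (fun l : ℝ ↦ 1 / 2 * l ^ (-(1 / 2) : ℝ)) volume 0 x :=
    (intervalIntegral.intervalIntegrable_rpow' (by norm_num)).const_mul _
  rw [← ofReal_integral_eq_lintegral_ofReal]
  · rw [← intervalIntegral.integral_of_le hx.le, intervalIntegral.integral_const_mul,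
      integral_rpow (Or.inl (by norm_num))]
    congr 1
    rw [Real.zero_rpow (by norm_num)]
    norm_num
    ring
  · exact (intervalIntegrable_iff_integrableOn_Ioc_of_le hx.le).1 hi
  · filter_upwards [self_mem_ae_restrict measurableSet_Ioc] with l hl
    have : 0 < l := hl.1
    positivity

/-- If the distribution function of `G` satisfies `ν {G ≤ c} ≤ c`, then `∫ G^{-1/2} dν` is at
most `2 ν(univ)^{1/2}`: write `G^{-1/2}` as the integral of `λ^{-3/2} / 2` over `λ > G`. -/
lemma lintegral_rpow_neg_half_le {α : Type*} [MeasurableSpace α] (ν : Measure α) [SFinite ν]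
    {G : α → ℝ≥0∞} (hG : Measurable G) (h : ∀ c, ν {t | G t ≤ c} ≤ c) :
    ∫⁻ t, (G t) ^ (-(1 / 2) : ℝ) ∂ν ≤ 2 * (ν univ) ^ (1 / 2 : ℝ) := by
  rcases eq_or_ne (ν univ) ∞ with hinf | hfin
  · rw [hinf]; simp
  rcases eq_or_ne (ν univ) 0 with h0 | h0
  · rw [Measure.measure_univ_eq_zero] at h0
    simp [h0]
  obtain ⟨m, hm⟩ : ∃ m : ℝ, m = (ν univ).toReal := ⟨_, rfl⟩
  have hm0 : 0 < m := hm ▸ ENNReal.toReal_pos h0 hfin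
  have hνm : ν univ = ENNReal.ofReal m := by rw [hm, ENNReal.ofReal_toReal hfin]
  have hpos : ∀ᵐ t ∂ν, G t ≠ 0 := by
    rw [ae_iff]
    simpa using h 0
  set k : ℝ → ℝ≥0∞ := fun l ↦ ENNReal.ofReal (1 / 2 * l ^ (-(3 / 2) : ℝ)) with hk
  have hkm : Measurable k := by fun_prop
  let F : α → ℝ → ℝ≥0∞ := fun t l ↦ {p : α × ℝ | G p.1 ≤ ENNReal.ofReal p.2}.indicator
    (fun p ↦ k p.2) (t, l)
  have hset : MeasurableSet {p : α × ℝ | G p.1 ≤ ENNReal.ofReal p.2} :=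
    measurableSet_le (by fun_prop) (by fun_prop)
  have hFm : Measurable (Function.uncurry F) := by
    apply Measurable.indicator (by fun_prop) hset
  have h1 : ∀ᵐ t ∂ν, (G t) ^ (-(1 / 2) : ℝ) ≤ ∫⁻ l in Ioi (0 : ℝ), F t l := by
    filter_upwards [hpos] with t ht
    rcases eq_or_ne (G t) ∞ with hti | hti
    · simp [hti]
    · have hx : 0 < (G t).toReal := ENNReal.toReal_pos ht hti
      have : (G t) ^ (-(1 / 2) : ℝ) = ∫⁻ l in Ioi (G t).toReal, k l := by
        rw [lintegral_Ioi_rpow hx, ← ENNReal.ofReal_rpow_of_pos hx, ENNReal.ofReal_toReal hti]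
      rw [this]
      calc ∫⁻ l in Ioi (G t).toReal, k l ≤ ∫⁻ l in Ioi (G t).toReal, F t l := by
            apply setLIntegral_mono' measurableSet_Ioi
            intro l hl
            have : G t ≤ ENNReal.ofReal l := by
              rw [← ENNReal.ofReal_toReal hti]
              exact ENNReal.ofReal_le_ofReal (le_of_lt hl)
            simp only [F]
            rw [indicator_of_mem (by exact this)]
        _ ≤ ∫⁻ l in Ioi 0, F t l :=
            lintegral_mono_set (Ioi_subset_Ioi hx.le)
  have h2 : ∀ l ∈ Ioi (0 : ℝ),
      ∫⁻ t, F t l ∂ν ≤ k l * min (ENNReal.ofReal l) (ENNReal.ofReal m) := by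
    intro l _
    have : (fun t ↦ F t l) = {t | G t ≤ ENNReal.ofReal l}.indicator (fun _ ↦ k l) := by
      ext t; simp [F, indicator]
    rw [this, lintegral_indicator (measurableSet_le hG measurable_const), setLIntegral_const]
    gcongr
    exact le_min (h _) (hνm ▸ measure_mono (subset_univ _))
  calc ∫⁻ t, (G t) ^ (-(1 / 2) : ℝ) ∂ν ≤ ∫⁻ t, (∫⁻ l in Ioi (0 : ℝ), F t l) ∂ν :=
        lintegral_mono_ae h1
    _ = ∫⁻ l in Ioi 0, ∫⁻ t, F t l ∂ν := lintegral_lintegral_swap hFm.aemeasurable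
    _ ≤ ∫⁻ l in Ioi 0, k l * min (ENNReal.ofReal l) (ENNReal.ofReal m) :=
        setLIntegral_mono' measurableSet_Ioi h2
    _ ≤ (∫⁻ l in Ioc 0 m, k l * min (ENNReal.ofReal l) (ENNReal.ofReal m)) +
        ∫⁻ l in Ioi m, k l * min (ENNReal.ofReal l) (ENNReal.ofReal m) := by
        rw [← Ioc_union_Ioi_eq_Ioi hm0.le]
        exact lintegral_union_le _ _ _
    _ ≤ (∫⁻ l in Ioc 0 m, ENNReal.ofReal (1 / 2 * l ^ (-(1 / 2) : ℝ))) +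
        ∫⁻ l in Ioi m, k l * ENNReal.ofReal m := by
        gcongr ?_ + ?_
        · apply setLIntegral_mono' measurableSet_Ioc
          intro l hl
          refine (mul_le_mul_right (min_le_left _ _) _).trans ?_
          have hl0 : 0 < l := hl.1
          rw [hk, ← ENNReal.ofReal_mul (by positivity)]
          apply ENNReal.ofReal_le_ofReal
          rw [mul_assoc, ← Real.rpow_add_one hl0.ne']
          norm_num
        · exact lintegral_mono fun l ↦ mul_le_mul_right (min_le_right _ _) _
    _ = 2 * (ν univ) ^ (1 / 2 : ℝ) := by
        rw [lintegral_Ioc_rpow hm0, lintegral_mul_const _ hkm, lintegral_Ioi_rpow hm0,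
          ← ENNReal.ofReal_mul (by positivity), ← Real.rpow_add_one hm0.ne', hνm,
          ENNReal.ofReal_rpow_of_pos hm0, two_mul]
        norm_num

lemma sq_rpow_half (x : ℝ≥0∞) : (x ^ (1 / 2 : ℝ)) ^ 2 = x := by
  rw [← ENNReal.rpow_natCast, ← ENNReal.rpow_mul]; norm_num

/-- Cauchy–Schwarz with an arbitrary weight `s`. -/
lemma sq_lintegral_le_weighted {α : Type*} [MeasurableSpace α] (ν : Measure α)
    {g s : α → ℝ≥0∞} (hg : AEMeasurable g ν) (hs : AEMeasurable s ν)
    (h0 : ∀ᵐ t ∂ν, s t ≠ 0 ∧ s t ≠ ∞) :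
    (∫⁻ t, g t ∂ν) ^ 2 ≤ (∫⁻ t, g t ^ 2 * s t ∂ν) * ∫⁻ t, (s t)⁻¹ ∂ν := by
  have key := ENNReal.lintegral_mul_le_Lp_mul_Lq ν Real.HolderConjugate.two_two
    (f := fun t ↦ g t * (s t) ^ (1 / 2 : ℝ)) (g := fun t ↦ ((s t)⁻¹) ^ (1 / 2 : ℝ))
    (by fun_prop) (by fun_prop)
  have e1 : ∫⁻ t, g t ∂ν = ∫⁻ a, ((fun t ↦ g t * (s t) ^ (1 / 2 : ℝ)) *
      fun t ↦ ((s t)⁻¹) ^ (1 / 2 : ℝ)) a ∂ν := by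
    apply lintegral_congr_ae
    filter_upwards [h0] with t ht
    simp only [Pi.mul_apply]
    rw [mul_assoc, ← ENNReal.mul_rpow_of_nonneg _ _ (by norm_num),
      ENNReal.mul_inv_cancel ht.1 ht.2]
    simp
  rw [← e1] at key
  calc (∫⁻ t, g t ∂ν) ^ 2 ≤ _ := pow_le_pow_left' key 2
    _ = _ := by
      simp only [ENNReal.rpow_two]
      rw [mul_pow, sq_rpow_half, sq_rpow_half]
      simp only [mul_pow, sq_rpow_half]

/-- Hardy's inequality along a measurable relation `E`, given the two estimates that the
distribution functions of `ν` and `μ` provide when `E` is a strict linear order. -/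
lemma lintegral_sq_le_of_relation {α : Type*} [MeasurableSpace α] (μ ν : Measure α)
    [SFinite μ] [SFinite ν] {E : Set (α × α)} (hE : MeasurableSet E) {B : ℝ≥0∞}
    {g : α → ℝ≥0∞} (hg : Measurable g)
    (h1 : ∀ r, ∫⁻ t in {t | (t, r) ∈ E}, (ν {s | (s, t) ∈ E}) ^ (-(1 / 2) : ℝ) ∂ν ≤
      2 * (ν {s | (s, r) ∈ E}) ^ (1 / 2 : ℝ))
    (h2 : ∀ t, ∫⁻ r in {r | (t, r) ∈ E}, (μ {s | (r, s) ∈ E}) ^ (-(1 / 2) : ℝ) ∂μ ≤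
      2 * (μ {s | (t, s) ∈ E}) ^ (1 / 2 : ℝ))
    (hν : ∀ᵐ t ∂ν, ν {s | (s, t) ∈ E} ≠ 0 ∧ ν {s | (s, t) ∈ E} ≠ ∞)
    (hμ : ∀ᵐ t ∂μ, μ {s | (t, s) ∈ E} ≠ 0 ∧ μ {s | (t, s) ∈ E} ≠ ∞)
    (hBν : ∀ᵐ t ∂ν, ν {s | (s, t) ∈ E} * μ {s | (t, s) ∈ E} ≤ B)
    (hBμ : ∀ᵐ t ∂μ, ν {s | (s, t) ∈ E} * μ {s | (t, s) ∈ E} ≤ B) :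
    ∫⁻ r, (∫⁻ t in {t | (t, r) ∈ E}, g t ∂ν) ^ 2 ∂μ ≤ 4 * B * ∫⁻ t, g t ^ 2 ∂ν := by
  set G : α → ℝ≥0∞ := fun t ↦ ν {s | (s, t) ∈ E}
  set U : α → ℝ≥0∞ := fun t ↦ μ {s | (t, s) ∈ E}
  have hGm : Measurable G := measurable_measure_prodMk_right hE
  have hUm : Measurable U := measurable_measure_prodMk_left hE
  have hEr : ∀ r, MeasurableSet {t | (t, r) ∈ E} := fun r ↦ measurable_prodMk_right hE
  have hEt : ∀ t, MeasurableSet {r | (t, r) ∈ E} := fun t ↦ measurable_prodMk_left hE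
  let W : α → α → ℝ≥0∞ := fun r t ↦ E.indicator (fun p ↦ (U p.2) ^ (-(1 / 2) : ℝ) *
    (g p.1 ^ 2 * (G p.1) ^ (1 / 2 : ℝ))) (t, r)
  have hWm : Measurable (Function.uncurry W) := by
    have : Measurable (E.indicator (fun p ↦ (U p.2) ^ (-(1 / 2) : ℝ) *
      (g p.1 ^ 2 * (G p.1) ^ (1 / 2 : ℝ)))) := Measurable.indicator (by fun_prop) hE
    exact this.comp measurable_swap
  have step1 : ∀ᵐ r ∂μ, (∫⁻ t in {t | (t, r) ∈ E}, g t ∂ν) ^ 2 ≤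
      2 * B ^ (1 / 2 : ℝ) * ∫⁻ t, W r t ∂ν := by
    filter_upwards [hμ, hBμ] with r hr hBr
    have hGU : (G r) ^ (1 / 2 : ℝ) ≤ B ^ (1 / 2 : ℝ) * (U r) ^ (-(1 / 2) : ℝ) := by
      have : G r ≤ B * (U r)⁻¹ := by
        rw [← div_eq_mul_inv, ENNReal.le_div_iff_mul_le (Or.inl hr.1) (Or.inl hr.2)]
        exact hBr
      calc (G r) ^ (1 / 2 : ℝ) ≤ (B * (U r)⁻¹) ^ (1 / 2 : ℝ) := by gcongr
        _ = _ := by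
          rw [ENNReal.mul_rpow_of_nonneg _ _ (by norm_num), ENNReal.inv_rpow, ENNReal.rpow_neg]
    have hW : ∫⁻ t, W r t ∂ν = (U r) ^ (-(1 / 2) : ℝ) *
        ∫⁻ t in {t | (t, r) ∈ E}, g t ^ 2 * (G t) ^ (1 / 2 : ℝ) ∂ν := by
      rw [← lintegral_const_mul _ (by fun_prop), ← lintegral_indicator (hEr r)]
      rfl
    calc (∫⁻ t in {t | (t, r) ∈ E}, g t ∂ν) ^ 2
        ≤ (∫⁻ t in {t | (t, r) ∈ E}, g t ^ 2 * (G t) ^ (1 / 2 : ℝ) ∂ν) *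
          ∫⁻ t in {t | (t, r) ∈ E}, ((G t) ^ (1 / 2 : ℝ))⁻¹ ∂ν := by
          apply sq_lintegral_le_weighted _ (by fun_prop) (by fun_prop)
          filter_upwards [ae_restrict_of_ae hν] with t ht
          have h3 : G t ≠ 0 ∧ G t ≠ ∞ := ht
          constructor <;> simp [h3]
      _ ≤ (∫⁻ t in {t | (t, r) ∈ E}, g t ^ 2 * (G t) ^ (1 / 2 : ℝ) ∂ν) *
          (2 * (G r) ^ (1 / 2 : ℝ)) := by
          gcongr
          simp_rw [← ENNReal.rpow_neg]
          exact h1 r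
      _ ≤ (∫⁻ t in {t | (t, r) ∈ E}, g t ^ 2 * (G t) ^ (1 / 2 : ℝ) ∂ν) *
          (2 * (B ^ (1 / 2 : ℝ) * (U r) ^ (-(1 / 2) : ℝ))) := by gcongr
      _ = _ := by rw [hW]; ring
  have step2 : ∀ᵐ t ∂ν, ∫⁻ r, W r t ∂μ ≤ 2 * B ^ (1 / 2 : ℝ) * g t ^ 2 := by
    filter_upwards [hBν] with t hBt
    have hW : ∫⁻ r, W r t ∂μ = (g t ^ 2 * (G t) ^ (1 / 2 : ℝ)) *
        ∫⁻ r in {r | (t, r) ∈ E}, (U r) ^ (-(1 / 2) : ℝ) ∂μ := by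
      rw [← lintegral_const_mul _ (by fun_prop), ← lintegral_indicator (hEt t)]
      congr 1 with r
      by_cases h : (t, r) ∈ E
      · rw [indicator_of_mem (by exact h)]
        simp only [W]
        rw [indicator_of_mem h, mul_comm]
      · rw [indicator_of_notMem (by exact h)]
        simp only [W]
        rw [indicator_of_notMem h]
    rw [hW]
    calc _ ≤ (g t ^ 2 * (G t) ^ (1 / 2 : ℝ)) * (2 * (U t) ^ (1 / 2 : ℝ)) := by
          gcongr; exact h2 t
      _ = 2 * (G t * U t) ^ (1 / 2 : ℝ) * g t ^ 2 := by
          rw [ENNReal.mul_rpow_of_nonneg _ _ (by norm_num)]; ring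
      _ ≤ _ := by gcongr
  calc ∫⁻ r, (∫⁻ t in {t | (t, r) ∈ E}, g t ∂ν) ^ 2 ∂μ
      ≤ ∫⁻ r, 2 * B ^ (1 / 2 : ℝ) * ∫⁻ t, W r t ∂ν ∂μ := lintegral_mono_ae step1
    _ = 2 * B ^ (1 / 2 : ℝ) * ∫⁻ r, ∫⁻ t, W r t ∂ν ∂μ :=
        lintegral_const_mul _ hWm.lintegral_prod_right'
    _ = 2 * B ^ (1 / 2 : ℝ) * ∫⁻ t, ∫⁻ r, W r t ∂μ ∂ν := by
        rw [lintegral_lintegral_swap hWm.aemeasurable]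
    _ ≤ 2 * B ^ (1 / 2 : ℝ) * ∫⁻ t, 2 * B ^ (1 / 2 : ℝ) * g t ^ 2 ∂ν := by
        gcongr 2 * B ^ (1 / 2 : ℝ) * ?_
        exact lintegral_mono_ae step2
    _ = 4 * (B ^ (1 / 2 : ℝ)) ^ 2 * ∫⁻ t, g t ^ 2 ∂ν := by
        rw [lintegral_const_mul _ (by fun_prop)]; ring
    _ = _ := by rw [sq_rpow_half]

lemma lintegral_Iio_measure_Iio_rpow_le (ν : Measure ℝ) [SFinite ν] [NullSingletonClass ν] (r : ℝ) :
    ∫⁻ t in Iio r, (ν (Iio t)) ^ (-(1 / 2) : ℝ) ∂ν ≤ 2 * (ν (Iio r)) ^ (1 / 2 : ℝ) := by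
  have hm : Measurable fun t ↦ ν (Iio t) :=
    Monotone.measurable fun a b hab ↦ measure_mono (Iio_subset_Iio hab)
  refine (lintegral_rpow_neg_half_le (ν.restrict (Iio r)) hm fun c ↦ ?_).trans_eq (by simp)
  rw [Measure.restrict_apply (measurableSet_le hm measurable_const)]
  exact measure_le_of_forall_inter_Iio ν fun t ht ↦ (measure_mono inter_subset_right).trans ht.1

lemma lintegral_Ioi_measure_Ioi_rpow_le (ν : Measure ℝ) [SFinite ν] [NullSingletonClass ν] (r : ℝ) :
    ∫⁻ t in Ioi r, (ν (Ioi t)) ^ (-(1 / 2) : ℝ) ∂ν ≤ 2 * (ν (Ioi r)) ^ (1 / 2 : ℝ) := by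
  have hm : Measurable fun t ↦ ν (Ioi t) :=
    Antitone.measurable fun a b hab ↦ measure_mono (Ioi_subset_Ioi hab)
  refine (lintegral_rpow_neg_half_le (ν.restrict (Ioi r)) hm fun c ↦ ?_).trans_eq (by simp)
  rw [Measure.restrict_apply (measurableSet_le hm measurable_const)]
  exact measure_le_of_forall_inter_Ioi ν fun t ht ↦ (measure_mono inter_subset_right).trans ht.1

/-- **Muckenhoupt's form of Hardy's inequality** for two measures without atoms. -/
theorem hardy_Iio (μ ν : Measure ℝ) [SFinite μ] [SFinite ν] [NullSingletonClass μ]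
    [NullSingletonClass ν] {B : ℝ≥0∞} {g : ℝ → ℝ≥0∞} (hg : Measurable g)
    (hν : ∀ᵐ t ∂ν, ν (Iio t) ≠ 0 ∧ ν (Iio t) ≠ ∞) (hμ : ∀ᵐ t ∂μ, μ (Ioi t) ≠ 0 ∧ μ (Ioi t) ≠ ∞)
    (hBν : ∀ᵐ t ∂ν, ν (Iio t) * μ (Ioi t) ≤ B) (hBμ : ∀ᵐ t ∂μ, ν (Iio t) * μ (Ioi t) ≤ B) :
    ∫⁻ r, (∫⁻ t in Iio r, g t ∂ν) ^ 2 ∂μ ≤ 4 * B * ∫⁻ t, g t ^ 2 ∂ν :=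
  lintegral_sq_le_of_relation μ ν (E := {p | p.1 < p.2})
    (measurableSet_lt measurable_fst measurable_snd) hg
    (lintegral_Iio_measure_Iio_rpow_le ν) (lintegral_Ioi_measure_Ioi_rpow_le μ) hν hμ hBν hBμ

/-- The dual of `hardy_Iio`, for integration over `(r, ∞)`. -/
theorem hardy_Ioi (μ ν : Measure ℝ) [SFinite μ] [SFinite ν] [NullSingletonClass μ]
    [NullSingletonClass ν] {B : ℝ≥0∞} {g : ℝ → ℝ≥0∞} (hg : Measurable g)
    (hν : ∀ᵐ t ∂ν, ν (Ioi t) ≠ 0 ∧ ν (Ioi t) ≠ ∞) (hμ : ∀ᵐ t ∂μ, μ (Iio t) ≠ 0 ∧ μ (Iio t) ≠ ∞)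
    (hBν : ∀ᵐ t ∂ν, ν (Ioi t) * μ (Iio t) ≤ B) (hBμ : ∀ᵐ t ∂μ, ν (Ioi t) * μ (Iio t) ≤ B) :
    ∫⁻ r, (∫⁻ t in Ioi r, g t ∂ν) ^ 2 ∂μ ≤ 4 * B * ∫⁻ t, g t ^ 2 ∂ν :=
  lintegral_sq_le_of_relation μ ν (E := {p | p.2 < p.1})
    (measurableSet_lt measurable_snd measurable_fst) hg
    (lintegral_Ioi_measure_Ioi_rpow_le ν) (lintegral_Iio_measure_Iio_rpow_le μ) hν hμ hBν hBμ

/-! ### Parseval's identity on circles and polar coordinates -/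

section Parseval

open Filter Topology Polynomial

/-- **Parseval's identity** for absolutely convergent power series on the unit circle. -/
lemma hasSum_sq_norm_of_summable {a : ℕ → ℂ} (ha : Summable fun n ↦ ‖a n‖) :
    HasSum (fun n ↦ ‖a n‖ ^ 2)
      (Real.circleAverage (fun w ↦ ‖∑' n, a n * w ^ n‖ ^ 2) 0 1) := by
  let p : ℕ → ℂ[X] := fun N ↦ ∑ n ∈ Finset.range N, monomial n (a n)
  have hcoeff : ∀ N i, (p N).coeff i = if i < N then a i else 0 := by
    intro N i
    simp [p, coeff_monomial]
  have hsum : ∀ N, ∑ i ∈ (p N).support, ‖(p N).coeff i‖ ^ 2 =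
      ∑ i ∈ Finset.range N, ‖a i‖ ^ 2 := by
    intro N
    have : ∑ i ∈ Finset.range N, ‖a i‖ ^ 2 = ∑ i ∈ Finset.range N, ‖(p N).coeff i‖ ^ 2 := by
      refine Finset.sum_congr rfl fun i hi ↦ ?_
      rw [hcoeff, if_pos (Finset.mem_range.1 hi)]
    rw [this]
    refine Finset.sum_subset (fun i hi ↦ ?_) fun i _ hi ↦ ?_
    · rw [mem_support_iff, hcoeff] at hi
      by_contra h
      rw [Finset.mem_range] at h
      simp [h] at hi
    · rw [notMem_support_iff.1 hi]; simp
  have heval : ∀ N (w : ℂ), (p N).eval w = ∑ n ∈ Finset.range N, a n * w ^ n := by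
    intro N w
    simp [p, eval_finsetSum]
  have hs2 : Summable fun n ↦ ‖a n‖ ^ 2 := by
    refine Summable.of_nonneg_of_le (fun _ ↦ by positivity) (fun n ↦ ?_)
      (ha.mul_left (∑' n, ‖a n‖))
    rw [sq]
    gcongr
    exact ha.le_tsum n fun _ _ ↦ norm_nonneg _
  have hcirc : ∀ θ : ℝ, ‖circleMap 0 1 θ‖ = 1 := by intro θ; simp
  have hlim : Tendsto (fun N ↦ Real.circleAverage (fun w ↦ ‖(p N).eval w‖ ^ 2) 0 1) atTop
      (𝓝 (Real.circleAverage (fun w ↦ ‖∑' n, a n * w ^ n‖ ^ 2) 0 1)) := by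
    unfold Real.circleAverage
    refine Tendsto.const_smul ?_ _
    refine intervalIntegral.tendsto_integral_filter_of_dominated_convergence
      (fun _ ↦ (∑' n, ‖a n‖) ^ 2) ?_ ?_ (by simp) ?_
    · refine Eventually.of_forall fun N ↦ Continuous.aestronglyMeasurable ?_
      have := (p N).continuous
      fun_prop
    · refine Eventually.of_forall fun N ↦ Eventually.of_forall fun θ _ ↦ ?_
      rw [Real.norm_of_nonneg (by positivity)]
      simp only [heval]
      gcongr
      refine (norm_sum_le _ _).trans ?_
      simp only [norm_mul, norm_pow, hcirc, one_pow, mul_one]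
      exact ha.sum_le_tsum _ fun _ _ ↦ norm_nonneg _
    · refine Eventually.of_forall fun θ _ ↦ ?_
      simp only [heval]
      refine (Tendsto.norm ?_).pow 2
      refine (Summable.hasSum ?_).tendsto_sum_nat
      refine Summable.of_norm ?_
      simpa only [norm_mul, norm_pow, hcirc, one_pow, mul_one] using ha
  rw [hs2.hasSum_iff_tendsto_nat]
  refine hlim.congr fun N ↦ ?_
  rw [← sum_sq_norm_coeff_eq_circleAverage, hsum]

/-- Parseval's identity on the circle of radius `ρ`, in the form that polar coordinates call for. -/
lemma lintegral_sq_enorm_circle {c : ℕ → ℂ} {ρ : ℝ} (hρ : 0 ≤ ρ)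
    (hc : Summable fun n ↦ ‖c n‖ * ρ ^ n) :
    ∫⁻ θ in Ioo (-Real.pi) Real.pi,
      ‖∑' n, c n * (ρ * (Real.cos θ + Real.sin θ * Complex.I)) ^ n‖ₑ ^ 2 =
      ENNReal.ofReal (2 * Real.pi) * ∑' n, ‖c n‖ₑ ^ 2 * ENNReal.ofReal ρ ^ (2 * n) := by
  have hpi := Real.pi_pos
  set a : ℕ → ℂ := fun n ↦ c n * ρ ^ n with ha
  have hna : ∀ n, ‖a n‖ = ‖c n‖ * ρ ^ n := fun n ↦ by simp [ha, abs_of_nonneg hρ]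
  have hsa : Summable fun n ↦ ‖a n‖ := by simpa only [hna] using hc
  have hP := hasSum_sq_norm_of_summable hsa
  set g : ℝ → ℂ := fun θ ↦ ∑' n, a n * (circleMap 0 1 θ) ^ n with hg
  have hgc : Continuous g := by
    refine continuous_tsum (fun n ↦ by fun_prop) hsa fun n θ ↦ ?_
    simp
  have hper : Function.Periodic (fun θ ↦ ‖g θ‖ ^ 2) (2 * Real.pi) := by
    intro θ
    simp only [hg, periodic_circleMap 0 1 θ]
  have e1 : ∀ θ : ℝ, ‖∑' n, c n * (ρ * (Real.cos θ + Real.sin θ * Complex.I)) ^ n‖ₑ ^ 2 =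
      ENNReal.ofReal (‖g θ‖ ^ 2) := by
    intro θ
    have : g θ = ∑' n, c n * (ρ * (Real.cos θ + Real.sin θ * Complex.I)) ^ n := by
      simp only [hg, ha]
      congr 1 with n
      have : circleMap 0 1 θ = Real.cos θ + Real.sin θ * Complex.I := by
        simp [circleMap, Complex.exp_mul_I]
      rw [this, mul_pow]; ring
    rw [← this, ENNReal.ofReal_pow (norm_nonneg _), ofReal_norm]
  simp_rw [e1]
  have hint : IntegrableOn (fun θ ↦ ‖g θ‖ ^ 2) (Ioo (-Real.pi) Real.pi) :=
    ((by fun_prop : Continuous fun θ ↦ ‖g θ‖ ^ 2).integrableOn_Icc).mono_set Ioo_subset_Icc_self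
  rw [← ofReal_integral_eq_lintegral_ofReal hint (Eventually.of_forall fun θ ↦ by positivity)]
  have e2 : ∫ θ in Ioo (-Real.pi) Real.pi, ‖g θ‖ ^ 2 = (2 * Real.pi) * ∑' n, ‖a n‖ ^ 2 := by
    rw [← integral_Ioc_eq_integral_Ioo, ← intervalIntegral.integral_of_le (by linarith)]
    have := hper.intervalIntegral_add_eq (-Real.pi) 0
    rw [show -Real.pi + 2 * Real.pi = Real.pi by ring, zero_add] at this
    rw [this, hP.tsum_eq, Real.circleAverage, smul_eq_mul, ← mul_assoc,
      mul_inv_cancel₀ (by positivity), one_mul]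
  rw [e2, ENNReal.ofReal_mul (by positivity), ENNReal.ofReal_tsum_of_nonneg
    (fun n ↦ by positivity) hP.summable]
  congr 1
  congr 1 with n
  rw [hna, mul_pow, ENNReal.ofReal_mul (by positivity), ENNReal.ofReal_pow (norm_nonneg _),
    ofReal_norm, ← pow_mul, mul_comm n 2, ENNReal.ofReal_pow hρ]

/-- The radial profile of a radial weight is a.e. measurable on `(0, 1)`. -/
lemma IsRadialWeight.aemeasurable {v : ℂ → ℝ} (hv : IsRadialWeight v) :
    AEMeasurable (fun r : ℝ ↦ v r) (volume.restrict (Ioo 0 1)) := by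
  have h1 : IntegrableOn (fun z : ℂ ↦ (fun r : ℝ ↦ v r) ‖z‖) (Metric.ball (0 : ℂ) 1) :=
    hv.integrable.congr_fun (fun z hz ↦ hv.radial z hz) measurableSet_ball
  replace h1 := (integrableOn_fun_norm_addHaar (f := fun r : ℝ ↦ v r) volume).1 h1
  simp only [Complex.finrank_real_complex] at h1
  have h2 : AEMeasurable (fun y : ℝ ↦ y⁻¹ * (y ^ (2 - 1) • v y)) (volume.restrict (Ioo 0 1)) :=
    measurable_inv.aemeasurable.mul h1.aestronglyMeasurable.aemeasurable
  refine h2.congr ?_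
  filter_upwards [self_mem_ae_restrict measurableSet_Ioo] with y hy
  have : y ≠ 0 := hy.1.ne'
  simp [this]

/-- The area integral of a power series against a radial weight, in polar coordinates. -/
lemma lintegral_ball_sq_enorm {v : ℂ → ℝ} (hv : IsRadialWeight v) {c : ℕ → ℂ} {g : ℂ → ℂ}
    (hc : ∀ ρ ∈ Ioo (0 : ℝ) 1, Summable fun n ↦ ‖c n‖ * ρ ^ n)
    (hgm : ContinuousOn g (Metric.ball 0 1))
    (hg : ∀ z ∈ Metric.ball (0 : ℂ) 1, g z = ∑' n, c n * z ^ n) :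
    (∫⁻ z in Metric.ball (0 : ℂ) 1, ‖g z‖ₑ ^ 2 * ENNReal.ofReal (v z)) /
        ENNReal.ofReal Real.pi =
      2 * ∫⁻ r in Ioo (0 : ℝ) 1, ENNReal.ofReal (v r) * ENNReal.ofReal r *
        ∑' n, ‖c n‖ₑ ^ 2 * ENNReal.ofReal r ^ (2 * n) := by
  have hpi := Real.pi_pos
  set F : ℝ × ℝ → ℝ≥0∞ := fun p ↦ ‖g (Complex.polarCoord.symm p)‖ₑ ^ 2 with hF
  have key : ∫⁻ z in Metric.ball (0 : ℂ) 1, ‖g z‖ₑ ^ 2 * ENNReal.ofReal (v z) =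
      ∫⁻ p in Ioo (0 : ℝ) 1 ×ˢ Ioo (-Real.pi) Real.pi,
        ENNReal.ofReal p.1 * (F p * ENNReal.ofReal (v p.1)) := by
    rw [← lintegral_indicator measurableSet_ball, ← Complex.lintegral_comp_polarCoord_symm]
    have hsub : Ioo (0 : ℝ) 1 ×ˢ Ioo (-Real.pi) Real.pi ⊆ polarCoord.target := by
      rw [polarCoord_target]
      exact prod_mono Ioo_subset_Ioi_self subset_rfl
    rw [← inter_eq_self_of_subset_left hsub, ← setLIntegral_indicator
      (measurableSet_Ioo.prod measurableSet_Ioo)]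
    refine setLIntegral_congr_fun polarCoord.open_target.measurableSet fun p hp ↦ ?_
    rw [polarCoord_target] at hp
    have hp0 : 0 < p.1 := hp.1
    have hnorm : ‖Complex.polarCoord.symm p‖ = p.1 := by
      rw [Complex.norm_polarCoord_symm, abs_of_pos hp0]
    by_cases h1 : p.1 < 1
    · have hb : Complex.polarCoord.symm p ∈ Metric.ball (0 : ℂ) 1 := by
        rw [mem_ball_zero_iff, hnorm]; exact h1
      rw [indicator_of_mem hb, indicator_of_mem (show p ∈ Ioo (0 : ℝ) 1 ×ˢ _ from
        ⟨⟨hp0, h1⟩, hp.2⟩), hv.radial _ hb, hnorm, smul_eq_mul]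
    · rw [indicator_of_notMem (by rwa [mem_ball_zero_iff, hnorm]), indicator_of_notMem
        (fun h ↦ h1 h.1.2), smul_zero]
  have hFm : AEMeasurable F (volume.restrict (Ioo (0 : ℝ) 1 ×ˢ Ioo (-Real.pi) Real.pi)) := by
    refine AEMeasurable.pow_const (AEMeasurable.enorm ?_) 2
    refine ContinuousOn.aemeasurable ?_ (measurableSet_Ioo.prod measurableSet_Ioo)
    refine hgm.comp (Continuous.continuousOn ?_) fun p hp ↦ ?_
    · have hsymm : (Complex.polarCoord.symm : ℝ × ℝ → ℂ) =
          fun p ↦ p.1 * (Real.cos p.2 + Real.sin p.2 * Complex.I) :=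
        funext Complex.polarCoord_symm_apply
      change Continuous (Complex.polarCoord.symm : ℝ × ℝ → ℂ)
      rw [hsymm]
      fun_prop
    · rw [mem_ball_zero_iff, Complex.norm_polarCoord_symm, abs_of_pos hp.1.1]
      exact hp.1.2
  have hvm : AEMeasurable (fun p : ℝ × ℝ ↦ v p.1)
      ((volume.restrict (Ioo (0 : ℝ) 1)).prod (volume.restrict (Ioo (-Real.pi) Real.pi))) :=
    hv.aemeasurable.comp_quasiMeasurePreserving Measure.quasiMeasurePreserving_fst
  rw [Measure.volume_eq_prod, ← Measure.prod_restrict] at hFm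
  have hprod : AEMeasurable (fun p : ℝ × ℝ ↦
      ENNReal.ofReal p.1 * (F p * ENNReal.ofReal (v p.1)))
      ((volume.restrict (Ioo (0 : ℝ) 1)).prod (volume.restrict (Ioo (-Real.pi) Real.pi))) :=
    measurable_fst.ennreal_ofReal.aemeasurable.mul (hFm.mul hvm.ennreal_ofReal)
  rw [key, Measure.volume_eq_prod, ← Measure.prod_restrict, lintegral_prod _ hprod]
  set S : ℝ → ℝ≥0∞ := fun r ↦ ENNReal.ofReal (v r) * ENNReal.ofReal r *
    ∑' n, ‖c n‖ₑ ^ 2 * ENNReal.ofReal r ^ (2 * n) with hS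
  have inner : ∀ r ∈ Ioo (0 : ℝ) 1, ∫⁻ θ in Ioo (-Real.pi) Real.pi,
      ENNReal.ofReal r * (F (r, θ) * ENNReal.ofReal (v r)) =
      ENNReal.ofReal (2 * Real.pi) * S r := by
    intro r hr
    have e : ∀ θ : ℝ, F (r, θ) =
        ‖∑' n, c n * (r * (Real.cos θ + Real.sin θ * Complex.I)) ^ n‖ₑ ^ 2 := by
      intro θ
      change ‖g (Complex.polarCoord.symm (r, θ))‖ₑ ^ 2 = _
      rw [hg]
      · simp
      · rw [mem_ball_zero_iff, Complex.norm_polarCoord_symm, abs_of_pos hr.1]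
        exact hr.2
    calc ∫⁻ θ in Ioo (-Real.pi) Real.pi, ENNReal.ofReal r * (F (r, θ) * ENNReal.ofReal (v r))
        = ∫⁻ θ in Ioo (-Real.pi) Real.pi, (ENNReal.ofReal r * ENNReal.ofReal (v r)) *
          ‖∑' n, c n * (r * (Real.cos θ + Real.sin θ * Complex.I)) ^ n‖ₑ ^ 2 := by
          refine lintegral_congr fun θ ↦ ?_
          rw [e θ]; ring
      _ = _ := by
          rw [lintegral_const_mul' (ENNReal.ofReal r * ENNReal.ofReal (v r)) _ (by finiteness)]
          rw [lintegral_sq_enorm_circle hr.1.le (hc r hr)]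
          simp only [S]
          ring
  have houter : ∫⁻ r in Ioo (0 : ℝ) 1, ∫⁻ θ in Ioo (-Real.pi) Real.pi,
      ENNReal.ofReal r * (F (r, θ) * ENNReal.ofReal (v r)) =
      ENNReal.ofReal (2 * Real.pi) * ∫⁻ r in Ioo (0 : ℝ) 1, S r := by
    rw [setLIntegral_congr_fun measurableSet_Ioo inner, lintegral_const_mul' _ _ (by finiteness)]
  refine (congrArg (· / ENNReal.ofReal Real.pi) houter).trans ?_
  have hpi0 : ENNReal.ofReal Real.pi ≠ 0 := by simpa using hpi
  rw [ENNReal.ofReal_mul (by norm_num), mul_comm (ENNReal.ofReal 2), mul_assoc,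
    ENNReal.mul_div_right_comm, ENNReal.div_self hpi0 (by finiteness), one_mul]
  simp

end Parseval

/-! ### The Hilbert operator and the moments of its symbol -/

/-- The moment `∫_0^1 φ(t) tⁿ dt`, the `n`-th Taylor coefficient of `hilbertOp φ`. -/
def moment (φ : ℝ → ℂ) (n : ℕ) : ℂ := ∫ t in Ioo (0 : ℝ) 1, φ t * (t : ℂ) ^ n

/-- The absolute moment `∫_0^1 |φ(t)| tⁿ dt`. -/
def absMoment (φ : ℝ → ℂ) (n : ℕ) : ℝ≥0∞ :=
  ∫⁻ t in Ioo (0 : ℝ) 1, ‖φ t‖ₑ * ENNReal.ofReal t ^ n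

lemma sublinearHilbertOp_eq (φ : ℝ → ℂ) :
    sublinearHilbertOp φ = hilbertOp fun t ↦ (‖φ t‖ : ℂ) := rfl

lemma hilbertOp_zero (φ : ℝ → ℂ) : hilbertOp φ 0 = moment φ 0 := by
  simp [hilbertOp, moment]

lemma enorm_moment_le (φ : ℝ → ℂ) (n : ℕ) : ‖moment φ n‖ₑ ≤ absMoment φ n := by
  refine (enorm_integral_le_lintegral_enorm _).trans_eq ?_
  refine setLIntegral_congr_fun measurableSet_Ioo fun t ht ↦ ?_
  simp only [enorm_mul, enorm_pow]
  rw [← ofReal_norm (t : ℂ), Complex.norm_real, Real.norm_of_nonneg ht.1.le]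

lemma integrableOn_mul_pow {φ : ℝ → ℂ} (hφ : IntegrableOn φ (Ioo 0 1)) (n : ℕ) :
    IntegrableOn (fun t ↦ φ t * (t : ℂ) ^ n) (Ioo 0 1) := by
  refine Integrable.mul_bdd (c := 1) hφ (by fun_prop) ?_
  filter_upwards [self_mem_ae_restrict measurableSet_Ioo] with t ht
  rw [norm_pow, Complex.norm_real, Real.norm_of_nonneg ht.1.le]
  exact pow_le_one₀ ht.1.le ht.2.le

lemma enorm_moment_norm {φ : ℝ → ℂ} (hφ : IntegrableOn φ (Ioo 0 1)) (n : ℕ) :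
    ‖moment (fun t ↦ (‖φ t‖ : ℂ)) n‖ₑ = absMoment φ n := by
  have h1 : moment (fun t ↦ (‖φ t‖ : ℂ)) n =
      ((∫ t in Ioo (0 : ℝ) 1, ‖φ t * (t : ℂ) ^ n‖ : ℝ) : ℂ) := by
    rw [moment, ← integral_complex_ofReal]
    refine setIntegral_congr_fun measurableSet_Ioo fun t ht ↦ ?_
    simp [abs_of_pos ht.1]
  rw [h1, ← ofReal_norm, Complex.norm_real, Real.norm_of_nonneg (by positivity),
    ofReal_integral_norm_eq_lintegral_enorm (integrableOn_mul_pow hφ n)]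
  refine setLIntegral_congr_fun measurableSet_Ioo fun t ht ↦ ?_
  simp only [enorm_mul, enorm_pow]
  rw [← ofReal_norm (t : ℂ), Complex.norm_real, Real.norm_of_nonneg ht.1.le]

lemma one_sub_norm_le {t : ℝ} (ht : t ∈ Ioo (0 : ℝ) 1) (z : ℂ) :
    1 - ‖z‖ ≤ ‖1 - (t : ℂ) * z‖ := by
  have h1 : ‖(t : ℂ) * z‖ ≤ ‖z‖ := by
    rw [norm_mul, Complex.norm_real, Real.norm_of_nonneg ht.1.le]
    exact mul_le_of_le_one_left (norm_nonneg _) ht.2.le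
  have h2 := norm_sub_norm_le (1 : ℂ) (t * z)
  rw [norm_one] at h2
  linarith

lemma hasDerivAt_hilbertOp {φ : ℝ → ℂ} (hφ : IntegrableOn φ (Ioo 0 1)) {z : ℂ}
    (hz : z ∈ Metric.ball (0 : ℂ) 1) :
    HasDerivAt (hilbertOp φ) (∫ t in Ioo (0 : ℝ) 1, φ t * (t / (1 - t * z) ^ 2)) z := by
  rw [mem_ball_zero_iff] at hz
  obtain ⟨ρ, hzρ, hρ⟩ := exists_between hz
  have hs : Metric.ball (0 : ℂ) ρ ∈ nhds z := Metric.isOpen_ball.mem_nhds (by simpa using hzρ)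
  have hm : AEStronglyMeasurable φ (volume.restrict (Ioo 0 1)) := hφ.aestronglyMeasurable
  have hb : ∀ w ∈ Metric.ball (0 : ℂ) ρ, ∀ t ∈ Ioo (0 : ℝ) 1, 1 - ρ ≤ ‖1 - (t : ℂ) * w‖ := by
    intro w hw t ht
    rw [mem_ball_zero_iff] at hw
    linarith [one_sub_norm_le ht w]
  have h0 : (0 : ℝ) < 1 - ρ := by linarith
  refine (hasDerivAt_integral_of_dominated_loc_of_deriv_le
    (F := fun w (t : ℝ) ↦ φ t / (1 - (t : ℂ) * w))
    (F' := fun w (t : ℝ) ↦ φ t * (t / (1 - t * w) ^ 2))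
    (bound := fun t ↦ ‖φ t‖ * (1 / (1 - ρ) ^ 2)) hs ?_ ?_ ?_ ?_ ?_ ?_).2
  · refine Filter.Eventually.of_forall fun w ↦ ?_
    exact (hm.aemeasurable.div (by fun_prop)).aestronglyMeasurable
  · simp_rw [div_eq_mul_inv]
    refine Integrable.mul_bdd (c := 1 / (1 - ρ)) hφ (by fun_prop) ?_
    filter_upwards [self_mem_ae_restrict measurableSet_Ioo] with t ht
    rw [norm_inv, ← one_div]
    exact one_div_le_one_div_of_le h0 (hb z (by simpa using hzρ) t ht)
  · exact (hm.aemeasurable.mul (by fun_prop)).aestronglyMeasurable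
  · filter_upwards [self_mem_ae_restrict measurableSet_Ioo] with t ht w hw
    rw [norm_mul, norm_div, norm_pow, Complex.norm_real, Real.norm_of_nonneg ht.1.le]
    gcongr
    · exact ht.2.le
    · exact hb w hw t ht
  · exact hφ.norm.mul_const _
  · filter_upwards [self_mem_ae_restrict measurableSet_Ioo] with t ht w hw
    have hne : 1 - (t : ℂ) * w ≠ 0 := norm_pos_iff.1 (h0.trans_le (hb w hw t ht))
    have h1 : HasDerivAt (fun w : ℂ ↦ 1 - (t : ℂ) * w) (-t) w := by
      simpa using ((hasDerivAt_id w).const_mul (t : ℂ)).const_sub 1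
    have h2 := (h1.fun_inv hne).const_mul (φ t)
    simp only [neg_neg] at h2
    simpa only [div_eq_mul_inv] using h2

lemma differentiableOn_hilbertOp {φ : ℝ → ℂ} (hφ : IntegrableOn φ (Ioo 0 1)) :
    DifferentiableOn ℂ (hilbertOp φ) (Metric.ball 0 1) :=
  fun _ hz ↦ (hasDerivAt_hilbertOp hφ hz).differentiableAt.differentiableWithinAt

lemma norm_moment_le {φ : ℝ → ℂ} (hφ : IntegrableOn φ (Ioo 0 1)) (n : ℕ) :
    ‖moment φ n‖ ≤ ∫ t in Ioo (0 : ℝ) 1, ‖φ t‖ := by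
  refine norm_integral_le_of_norm_le hφ.norm ?_
  filter_upwards [self_mem_ae_restrict measurableSet_Ioo] with t ht
  rw [norm_mul, norm_pow, Complex.norm_real, Real.norm_of_nonneg ht.1.le]
  exact mul_le_of_le_one_right (norm_nonneg _) (pow_le_one₀ ht.1.le ht.2.le)

lemma hasSum_succ_mul_pow {x : ℂ} (hx : ‖x‖ < 1) :
    HasSum (fun n : ℕ ↦ ((n : ℂ) + 1) * x ^ n) (1 / (1 - x) ^ 2) := by
  simpa using hasSum_choose_mul_geometric_of_norm_lt_one 1 hx

lemma summable_succ_mul_pow {x : ℝ} (h0 : 0 ≤ x) (hx : x < 1) :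
    Summable (fun n : ℕ ↦ ((n : ℝ) + 1) * x ^ n) := by
  simpa using (hasSum_choose_mul_geometric_of_norm_lt_one 1
    (show ‖x‖ < 1 by rwa [Real.norm_of_nonneg h0])).summable

lemma summable_moment {φ : ℝ → ℂ} (hφ : IntegrableOn φ (Ioo 0 1)) {ρ : ℝ}
    (hρ : ρ ∈ Ico (0 : ℝ) 1) :
    Summable fun n : ℕ ↦ ‖((n : ℂ) + 1) * moment φ (n + 1)‖ * ρ ^ n := by
  refine Summable.of_nonneg_of_le (fun n ↦ mul_nonneg (norm_nonneg _) (pow_nonneg hρ.1 _))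
    (fun n ↦ ?_) ((summable_succ_mul_pow hρ.1 hρ.2).mul_left (∫ t in Ioo (0 : ℝ) 1, ‖φ t‖))
  have h1 : ‖(n : ℂ) + 1‖ = n + 1 := by
    exact_mod_cast Complex.norm_natCast (n + 1)
  rw [norm_mul, h1, mul_comm ((n : ℝ) + 1), mul_assoc]
  have := hρ.1
  gcongr
  exact norm_moment_le hφ _

lemma deriv_hilbertOp_eq_tsum {φ : ℝ → ℂ} (hφ : IntegrableOn φ (Ioo 0 1)) {z : ℂ}
    (hz : z ∈ Metric.ball (0 : ℂ) 1) :
    deriv (hilbertOp φ) z = ∑' n : ℕ, ((n : ℂ) + 1) * moment φ (n + 1) * z ^ n := by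
  rw [(hasDerivAt_hilbertOp hφ hz).deriv]
  rw [mem_ball_zero_iff] at hz
  have hI : ∀ n : ℕ, Integrable (fun t : ℝ ↦ ((n : ℂ) + 1) * z ^ n * (φ t * (t : ℂ) ^ (n + 1)))
      (volume.restrict (Ioo 0 1)) := fun n ↦ (integrableOn_mul_pow hφ (n + 1)).const_mul _
  have hS : Summable fun n : ℕ ↦ ∫ t in Ioo (0 : ℝ) 1,
      ‖((n : ℂ) + 1) * z ^ n * (φ t * (t : ℂ) ^ (n + 1))‖ := by
    refine Summable.of_nonneg_of_le (fun n ↦ integral_nonneg fun t ↦ norm_nonneg _) (fun n ↦ ?_)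
      ((summable_succ_mul_pow (norm_nonneg z) hz).mul_right (∫ t in Ioo (0 : ℝ) 1, ‖φ t‖))
    rw [← integral_const_mul]
    refine setIntegral_mono_on (hI n).norm (hφ.norm.const_mul _) measurableSet_Ioo fun t ht ↦ ?_
    have h1 : ‖(n : ℂ) + 1‖ = n + 1 := by
      exact_mod_cast Complex.norm_natCast (n + 1)
    rw [norm_mul, norm_mul, h1, norm_pow, norm_mul, norm_pow, Complex.norm_real,
      Real.norm_of_nonneg ht.1.le]
    gcongr
    exact mul_le_of_le_one_right (norm_nonneg _) (pow_le_one₀ ht.1.le ht.2.le)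
  have key := hasSum_integral_of_summable_integral_norm hI hS
  have e1 : ∀ n : ℕ, ∫ t in Ioo (0 : ℝ) 1, ((n : ℂ) + 1) * z ^ n * (φ t * (t : ℂ) ^ (n + 1)) =
      ((n : ℂ) + 1) * moment φ (n + 1) * z ^ n := by
    intro n
    rw [integral_const_mul, moment]; ring
  simp_rw [e1] at key
  rw [key.tsum_eq]
  refine setIntegral_congr_fun measurableSet_Ioo fun t ht ↦ ?_
  have htz : ‖(t : ℂ) * z‖ < 1 := by
    rw [norm_mul, Complex.norm_real, Real.norm_of_nonneg ht.1.le]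
    exact (mul_le_of_le_one_left (norm_nonneg _) ht.2.le).trans_lt hz
  have h2 := ((hasSum_succ_mul_pow htz).mul_left (φ t * t)).tsum_eq
  calc φ t * (t / (1 - t * z) ^ 2) = φ t * t * (1 / (1 - t * z) ^ 2) := by ring
    _ = _ := by
      rw [← h2]
      congr 1 with n
      ring

lemma continuousOn_deriv_hilbertOp {φ : ℝ → ℂ} (hφ : IntegrableOn φ (Ioo 0 1)) :
    ContinuousOn (deriv (hilbertOp φ)) (Metric.ball 0 1) :=
  ((differentiableOn_hilbertOp hφ).deriv Metric.isOpen_ball).continuousOn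

/-- The weighted energy `2 ∫_0^1 r v(r) ∑ (n + 1)² b_{n+1}² r^{2n} dr` of a sequence of
coefficient sizes `b`. -/
def energy (v : ℂ → ℝ) (b : ℕ → ℝ≥0∞) : ℝ≥0∞ :=
  2 * ∫⁻ r in Ioo (0 : ℝ) 1, ENNReal.ofReal (v r) * ENNReal.ofReal r *
    ∑' n : ℕ, ((n : ℝ≥0∞) + 1) ^ 2 * b (n + 1) ^ 2 * ENNReal.ofReal r ^ (2 * n)

lemma energy_mono (v : ℂ → ℝ) {b b' : ℕ → ℝ≥0∞} (h : ∀ n, b n ≤ b' n) :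
    energy v b ≤ energy v b' := by
  unfold energy
  gcongr
  exact h _

/-- The Dirichlet norm of `hilbertOp φ` in terms of the moments of `φ`. -/
lemma dirichletNorm_hilbertOp {v : ℂ → ℝ} (hv : IsRadialWeight v) {φ : ℝ → ℂ}
    (hφ : IntegrableOn φ (Ioo 0 1)) :
    dirichletNorm v (hilbertOp φ) =
      (‖moment φ 0‖ₑ ^ 2 + energy v fun n ↦ ‖moment φ n‖ₑ) ^ (1 / 2 : ℝ) := by
  rw [dirichletNorm, hilbertOp_zero, lintegral_ball_sq_enorm hv
    (fun ρ hρ ↦ summable_moment hφ (Ioo_subset_Ico_self hρ)) (continuousOn_deriv_hilbertOp hφ)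
    (fun z hz ↦ deriv_hilbertOp_eq_tsum hφ hz)]
  have h1 : ∀ n : ℕ, ‖(n : ℂ) + 1‖ₑ = (n : ℝ≥0∞) + 1 := by
    intro n
    have : ‖(n : ℂ) + 1‖ = ((n + 1 : ℕ) : ℝ) := by
      exact_mod_cast Complex.norm_natCast (n + 1)
    rw [← ofReal_norm, this, ENNReal.ofReal_natCast]
    push_cast
    rfl
  simp only [energy, enorm_mul, h1, mul_pow]

lemma dirichletNorm_sublinearHilbertOp {v : ℂ → ℝ} (hv : IsRadialWeight v) {φ : ℝ → ℂ}
    (hφ : IntegrableOn φ (Ioo 0 1)) :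
    dirichletNorm v (sublinearHilbertOp φ) =
      (absMoment φ 0 ^ 2 + energy v (absMoment φ)) ^ (1 / 2 : ℝ) := by
  have hφ' : IntegrableOn (fun t ↦ (‖φ t‖ : ℂ)) (Ioo 0 1) := hφ.norm.ofReal
  rw [sublinearHilbertOp_eq, dirichletNorm_hilbertOp hv hφ']
  simp_rw [enorm_moment_norm hφ]

lemma dirichletNorm_hilbertOp_le {v : ℂ → ℝ} (hv : IsRadialWeight v) {φ : ℝ → ℂ}
    (hφ : IntegrableOn φ (Ioo 0 1)) :
    dirichletNorm v (hilbertOp φ) ≤ dirichletNorm v (sublinearHilbertOp φ) := by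
  rw [dirichletNorm_hilbertOp hv hφ, dirichletNorm_sublinearHilbertOp hv hφ]
  gcongr
  · exact enorm_moment_le φ 0
  · exact energy_mono v (enorm_moment_le φ)

/-! ### Tails of a doubling weight -/

lemma vhat_antitone (v : ℂ → ℝ) : Antitone (vhat v) :=
  fun _ _ h ↦ lintegral_mono_set (Ioo_subset_Ioo_left h)

@[fun_prop]
lemma measurable_vhat (v : ℂ → ℝ) : Measurable (vhat v) := (vhat_antitone v).measurable

lemma setLIntegral_Ioo_ne_zero {f : ℝ → ℝ≥0∞} {a b : ℝ} (hab : a < b)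
    (hf : AEMeasurable f (volume.restrict (Ioo a b))) (h : ∀ s ∈ Ioo a b, f s ≠ 0) :
    ∫⁻ s in Ioo a b, f s ≠ 0 := by
  intro h0
  rw [lintegral_eq_zero_iff' hf] at h0
  have h1 : ∀ᵐ s ∂(volume.restrict (Ioo a b)), False := by
    filter_upwards [h0, self_mem_ae_restrict measurableSet_Ioo] with s hs hs'
    exact h s hs' hs
  rw [Filter.eventually_false_iff_eq_bot, ae_eq_bot, Measure.restrict_eq_zero, Real.volume_Ioo,
    ENNReal.ofReal_eq_zero] at h1
  linarith

lemma mul_ofReal_le_setLIntegral {f : ℝ → ℝ≥0∞} {a b : ℝ} {c : ℝ≥0∞}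
    (h : ∀ s ∈ Ioo a b, c ≤ f s) : c * ENNReal.ofReal (b - a) ≤ ∫⁻ s in Ioo a b, f s := by
  rw [← Real.volume_Ioo, ← setLIntegral_const]
  exact setLIntegral_mono' measurableSet_Ioo h

lemma vhat_ne_zero {v : ℂ → ℝ} (hv : IsRadialWeight v) {r : ℝ} (h0 : 0 ≤ r) (h1 : r < 1) :
    vhat v r ≠ 0 := by
  refine setLIntegral_Ioo_ne_zero h1 ?_ fun s hs ↦ ?_
  · exact (hv.aemeasurable.mono_set (Ioo_subset_Ioo_left h0)).ennreal_ofReal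
  · rw [Ne, ENNReal.ofReal_eq_zero, not_le]
    refine hv.pos _ ?_
    rw [mem_ball_zero_iff, Complex.norm_real, Real.norm_of_nonneg (h0.trans hs.1.le)]
    exact hs.2

lemma vhat_ne_top_of_pos {v : ℂ → ℝ} (hv : IsRadialWeight v) {r : ℝ} (h0 : 0 < r) :
    vhat v r ≠ ∞ := by
  have h1 : IntegrableOn (fun z : ℂ ↦ (fun r : ℝ ↦ v r) ‖z‖) (Metric.ball (0 : ℂ) 1) :=
    hv.integrable.congr_fun (fun z hz ↦ hv.radial z hz) measurableSet_ball
  replace h1 := (integrableOn_fun_norm_addHaar (f := fun r : ℝ ↦ v r) volume).1 h1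
  simp only [Complex.finrank_real_complex] at h1
  have h2 := (h1.mono_set (Ioo_subset_Ioo_left h0.le : Ioo r 1 ⊆ Ioo 0 1)).2
  have h3 : ENNReal.ofReal r * vhat v r ≤
      ∫⁻ y in Ioo r 1, ‖(y ^ (2 - 1) • v y : ℝ)‖ₑ := by
    rw [vhat, ← lintegral_const_mul' _ _ (by finiteness)]
    refine setLIntegral_mono' measurableSet_Ioo fun s hs ↦ ?_
    have hs0 : 0 < s := h0.trans hs.1
    rw [← ENNReal.ofReal_mul h0.le, ← ofReal_norm]
    apply ENNReal.ofReal_le_ofReal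
    have hvs : 0 < v s := by
      refine hv.pos _ ?_
      rw [mem_ball_zero_iff, Complex.norm_real, Real.norm_of_nonneg hs0.le]
      exact hs.2
    simp only [smul_eq_mul, norm_mul, Real.norm_eq_abs, abs_of_pos hvs, norm_pow, abs_of_pos hs0]
    norm_num
    gcongr
    exact hs.1.le
  intro htop
  rw [htop, ENNReal.mul_top (by simpa using h0), top_le_iff] at h3
  exact h2.ne h3

/-- Doubling bounds the tail on `(0, 1 / 2]`, hence also at `0`. -/
lemma vhat_zero_le {v : ℂ → ℝ} {K : ℝ≥0} (hK : DoublingWith v K) :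
    vhat v 0 ≤ K * vhat v (1 / 2) := by
  have hlim : Filter.Tendsto (fun n : ℕ ↦ vhat v (1 / ((n : ℝ) + 2))) Filter.atTop
      (nhds (vhat v 0)) := by
    have hU : (⋃ n : ℕ, Ioo (1 / ((n : ℝ) + 2)) 1) = Ioo 0 1 := by
      ext x
      simp only [mem_iUnion, mem_Ioo]
      constructor
      · rintro ⟨n, h1, h2⟩
        exact ⟨lt_trans (by positivity) h1, h2⟩
      · rintro ⟨h1, h2⟩
        obtain ⟨n, hn⟩ := exists_nat_one_div_lt h1
        refine ⟨n, lt_of_le_of_lt ?_ hn, h2⟩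
        gcongr
        norm_num
    have hm : Monotone fun n : ℕ ↦ Ioo (1 / ((n : ℝ) + 2)) 1 := by
      intro a b hab
      refine Ioo_subset_Ioo_left ?_
      have : (a : ℝ) ≤ b := by exact_mod_cast hab
      gcongr
    have := tendsto_measure_iUnion_atTop
      (μ := volume.withDensity fun s : ℝ ↦ ENNReal.ofReal (v s)) hm
    rw [hU] at this
    simpa only [vhat, Function.comp_def, withDensity_apply _ measurableSet_Ioo] using this
  refine le_of_tendsto' hlim fun n ↦ ?_
  have hn : 1 / ((n : ℝ) + 2) ∈ Ioo (0 : ℝ) 1 := by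
    refine ⟨by positivity, ?_⟩
    rw [div_lt_one (by positivity)]
    linarith [(n.cast_nonneg : (0 : ℝ) ≤ n)]
  refine (hK _ hn).trans ?_
  gcongr
  apply vhat_antitone
  linarith [hn.1]

lemma vhat_ne_top {v : ℂ → ℝ} (hv : MemDHat v) {r : ℝ} (h0 : 0 ≤ r) : vhat v r ≠ ∞ := by
  obtain ⟨hv, K, hK⟩ := hv
  have h1 := vhat_zero_le hK
  have h2 := vhat_ne_top_of_pos hv (show (0 : ℝ) < 1 / 2 by norm_num)
  have h3 : vhat v 0 ≠ ∞ := ne_top_of_le_ne_top (by finiteness) h1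
  exact ne_top_of_le_ne_top h3 (vhat_antitone v h0)

/-! ### The dual weight and the Muckenhoupt quantities -/

/-- The tail `∫_r^1 (1 - s)² / v̂(s) ds` of the dual weight of `V̂₂`. -/
def dualTail (v : ℂ → ℝ) (r : ℝ) : ℝ≥0∞ :=
  ∫⁻ s in Ioo r 1, ENNReal.ofReal ((1 - s) ^ 2) * (vhat v s)⁻¹

lemma ofReal_one_sub_pow_div {s : ℝ} (hs : s < 1) (a : ℝ≥0∞) (k : ℕ) :
    a / ENNReal.ofReal (1 - s) ^ k = a * ENNReal.ofReal (1 / (1 - s) ^ k) := by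
  have h : 0 < 1 - s := by linarith
  rw [div_eq_mul_inv, ← ENNReal.ofReal_pow h.le, one_div, ENNReal.ofReal_inv_of_pos (by positivity)]

lemma dualTail_eq (v : ℂ → ℝ) (r : ℝ) :
    ∫⁻ s in Ioo r 1, ENNReal.ofReal (1 - s) ^ 2 / vhat v s = dualTail v r := by
  refine setLIntegral_congr_fun measurableSet_Ioo fun s hs ↦ ?_
  have : 0 ≤ 1 - s := by linarith [hs.2]
  simp only [div_eq_mul_inv, ENNReal.ofReal_pow this]

lemma dualTail_antitone (v : ℂ → ℝ) : Antitone (dualTail v) :=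
  fun _ _ h ↦ lintegral_mono_set (Ioo_subset_Ioo_left h)

lemma IntegrabilityCondition.dualTail_ne_top {v : ℂ → ℝ} (h : IntegrabilityCondition v) {r : ℝ}
    (hr : 0 ≤ r) : dualTail v r ≠ ∞ := by
  rw [IntegrabilityCondition, dualTail_eq] at h
  exact ne_top_of_le_ne_top h.ne (dualTail_antitone v hr)

lemma mul_le_sq_M₁ (v : ℂ → ℝ) {r : ℝ} (hr : r ∈ Ioo (0 : ℝ) 1) :
    (∫⁻ s in Ioo r 1, vhat v s * ENNReal.ofReal (1 / (1 - s) ^ 2)) *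
      (∫⁻ s in Ioo 0 r, (vhat v s)⁻¹) ≤ M₁ v ^ 2 := by
  have h1 : (∫⁻ s in Ioo r 1, vhat v s / ENNReal.ofReal (1 - s) ^ 2) ^ (1 / 2 : ℝ) *
      (∫⁻ s in Ioo 0 r, 1 / vhat v s) ^ (1 / 2 : ℝ) ≤ M₁ v :=
    le_iSup₂ (f := fun (r : ℝ) (_ : r ∈ Ioo (0 : ℝ) 1) ↦
      (∫⁻ s in Ioo r 1, vhat v s / ENNReal.ofReal (1 - s) ^ 2) ^ (1 / 2 : ℝ) *
      (∫⁻ s in Ioo 0 r, 1 / vhat v s) ^ (1 / 2 : ℝ)) r hr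
  have h2 := pow_le_pow_left' h1 2
  rw [mul_pow, sq_rpow_half, sq_rpow_half] at h2
  simp only [one_div (vhat _ _)] at h2
  rwa [setLIntegral_congr_fun measurableSet_Ioo
    fun s hs ↦ ofReal_one_sub_pow_div hs.2 (vhat v s) 2] at h2

lemma M₂_term_eq (v : ℂ → ℝ) {r : ℝ} (hr : r < 1) :
    ∫⁻ s in Ioo 0 r, vhat v s / ENNReal.ofReal (1 - s) ^ 4 =
      ∫⁻ s in Ioo 0 r, vhat v s * ENNReal.ofReal (1 / (1 - s) ^ 4) :=
  setLIntegral_congr_fun measurableSet_Ioo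
    fun s hs ↦ ofReal_one_sub_pow_div (hs.2.trans hr) (vhat v s) 4

lemma mul_le_sq_M₂ (v : ℂ → ℝ) {r : ℝ} (hr : r ∈ Ioo (0 : ℝ) 1) :
    (∫⁻ s in Ioo 0 r, vhat v s * ENNReal.ofReal (1 / (1 - s) ^ 4)) * dualTail v r ≤
      M₂ v ^ 2 := by
  have h1 : (∫⁻ s in Ioo 0 r, vhat v s / ENNReal.ofReal (1 - s) ^ 4) ^ (1 / 2 : ℝ) *
      (∫⁻ s in Ioo r 1, ENNReal.ofReal (1 - s) ^ 2 / vhat v s) ^ (1 / 2 : ℝ) ≤ M₂ v :=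
    le_iSup₂ (f := fun (r : ℝ) (_ : r ∈ Ioo (0 : ℝ) 1) ↦
      (∫⁻ s in Ioo 0 r, vhat v s / ENNReal.ofReal (1 - s) ^ 4) ^ (1 / 2 : ℝ) *
      (∫⁻ s in Ioo r 1, ENNReal.ofReal (1 - s) ^ 2 / vhat v s) ^ (1 / 2 : ℝ)) r hr
  have h2 := pow_le_pow_left' h1 2
  rwa [mul_pow, sq_rpow_half, sq_rpow_half, dualTail_eq, M₂_term_eq v hr.2] at h2

lemma M₂_le {v : ℂ → ℝ} {c : ℝ≥0∞} (h : ∀ r ∈ Ioo (0 : ℝ) 1,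
    (∫⁻ s in Ioo 0 r, vhat v s * ENNReal.ofReal (1 / (1 - s) ^ 4)) * dualTail v r ≤ c ^ 2) :
    M₂ v ≤ c := by
  refine iSup₂_le fun r hr ↦ ?_
  rw [dualTail_eq, M₂_term_eq v hr.2, ← ENNReal.mul_rpow_of_nonneg _ _ (by norm_num)]
  calc _ ≤ (c ^ 2) ^ (1 / 2 : ℝ) := by gcongr; exact h r hr
    _ = c := by rw [← ENNReal.rpow_natCast, ← ENNReal.rpow_mul]; norm_num

lemma vhat_half_mul_le (v : ℂ → ℝ) :
    vhat v (1 / 2) * ENNReal.ofReal (1 / 2 - 0) ≤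
      ∫⁻ s in Ioo 0 (1 / 2), vhat v s * ENNReal.ofReal (1 / (1 - s) ^ 4) := by
  refine mul_ofReal_le_setLIntegral fun s hs ↦ ?_
  have hs1 : (1 - s) ^ 4 ≤ 1 := pow_le_one₀ (by linarith [hs.2]) (by linarith [hs.1])
  have hs2 : 0 < 1 - s := by linarith [hs.2]
  calc vhat v (1 / 2) ≤ vhat v s * 1 := by
        rw [mul_one]; exact vhat_antitone v hs.2.le
    _ ≤ _ := by
        gcongr
        rw [← ENNReal.ofReal_one]
        exact ENNReal.ofReal_le_ofReal (by rw [le_div_iff₀ (by positivity)]; linarith)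

/-- `M₂` is bounded below by an absolute constant, by monotonicity of the tail at `r = 1 / 2`. -/
lemma one_le_sq_M₂ {v : ℂ → ℝ} (hv : MemDHat v) : 1 ≤ 128 * M₂ v ^ 2 := by
  have h0 := vhat_ne_zero hv.1 (show (0 : ℝ) ≤ 1 / 2 by norm_num) (by norm_num)
  have ht := vhat_ne_top hv (show (0 : ℝ) ≤ 1 / 2 by norm_num)
  have h1 := vhat_half_mul_le v
  have h2 : (ENNReal.ofReal (1 / 16) * (vhat v (1 / 2))⁻¹) * ENNReal.ofReal (3 / 4 - 1 / 2) ≤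
      dualTail v (1 / 2) := by
    refine le_trans (mul_ofReal_le_setLIntegral
      (f := fun s ↦ ENNReal.ofReal ((1 - s) ^ 2) * (vhat v s)⁻¹) fun s hs ↦ ?_)
      (lintegral_mono_set (Ioo_subset_Ioo_right (by norm_num)))
    gcongr
    · nlinarith [hs.2]
    · exact vhat_antitone v hs.1.le
  have h3 := (mul_le_mul' h1 h2).trans (mul_le_sq_M₂ v ⟨by norm_num, by norm_num⟩)
  have h4 : vhat v (1 / 2) * ENNReal.ofReal (1 / 2 - 0) *
      (ENNReal.ofReal (1 / 16) * (vhat v (1 / 2))⁻¹ * ENNReal.ofReal (3 / 4 - 1 / 2)) =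
      ENNReal.ofReal (1 / 128) := by
    rw [show ENNReal.ofReal (1 / 128) = ENNReal.ofReal (1 / 2 - 0) * ENNReal.ofReal (1 / 16) *
      ENNReal.ofReal (3 / 4 - 1 / 2) by
        rw [← ENNReal.ofReal_mul (by norm_num), ← ENNReal.ofReal_mul (by norm_num)]; norm_num]
    calc _ = (vhat v (1 / 2) * (vhat v (1 / 2))⁻¹) * (ENNReal.ofReal (1 / 2 - 0) *
          ENNReal.ofReal (1 / 16) * ENNReal.ofReal (3 / 4 - 1 / 2)) := by ring
      _ = _ := by rw [ENNReal.mul_inv_cancel h0 ht, one_mul]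
  rw [h4] at h3
  calc (1 : ℝ≥0∞) = 128 * ENNReal.ofReal (1 / 128) := by
        rw [show (128 : ℝ≥0∞) = ENNReal.ofReal 128 by simp, ← ENNReal.ofReal_mul (by norm_num)]
        norm_num
    _ ≤ _ := by gcongr

/-- The quantity `M₁` controls the decay of the tail at geometric scale. -/
lemma vhat_le_mul_sq_M₁ {v : ℂ → ℝ} (hv : MemDHat v) {x : ℝ} (h0 : 0 < x) (h1 : x ≤ 1) :
    vhat v (1 - x / 4) ≤ 2 * M₁ v ^ 2 * vhat v (1 - x) := by
  have hn := vhat_ne_zero hv.1 (show 0 ≤ 1 - x by linarith) (by linarith)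
  have ht := vhat_ne_top hv (show 0 ≤ 1 - x by linarith)
  have e1 : (vhat v (1 - x / 4) * ENNReal.ofReal (1 / (x / 2) ^ 2)) *
      ENNReal.ofReal ((1 - x / 4) - (1 - x / 2)) ≤
      ∫⁻ s in Ioo (1 - x / 2) 1, vhat v s * ENNReal.ofReal (1 / (1 - s) ^ 2) := by
    refine le_trans (mul_ofReal_le_setLIntegral
      (f := fun s ↦ vhat v s * ENNReal.ofReal (1 / (1 - s) ^ 2)) fun s hs ↦ ?_)
      (lintegral_mono_set (Ioo_subset_Ioo_right (by linarith)))
    have := hs.2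
    have h3 : 0 < 1 - s := by linarith
    gcongr
    · exact vhat_antitone v hs.2.le
    · linarith [hs.1]
  have e2 : (vhat v (1 - x))⁻¹ * ENNReal.ofReal ((1 - x / 2) - (1 - x)) ≤
      ∫⁻ s in Ioo 0 (1 - x / 2), (vhat v s)⁻¹ := by
    refine le_trans (mul_ofReal_le_setLIntegral (f := fun s ↦ (vhat v s)⁻¹) fun s hs ↦ ?_)
      (lintegral_mono_set (Ioo_subset_Ioo_left (by linarith)))
    gcongr
    exact vhat_antitone v hs.1.le
  have e3 := (mul_le_mul' e1 e2).trans (mul_le_sq_M₁ v ⟨by linarith, by linarith⟩)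
  have e4 : vhat v (1 - x / 4) = 2 * (vhat v (1 - x / 4) * ENNReal.ofReal (1 / (x / 2) ^ 2) *
      ENNReal.ofReal ((1 - x / 4) - (1 - x / 2)) *
      ((vhat v (1 - x))⁻¹ * ENNReal.ofReal ((1 - x / 2) - (1 - x)))) * vhat v (1 - x) := by
    have : ENNReal.ofReal 2 * ENNReal.ofReal (1 / (x / 2) ^ 2) *
        ENNReal.ofReal ((1 - x / 4) - (1 - x / 2)) *
        ENNReal.ofReal ((1 - x / 2) - (1 - x)) = 1 := by
      rw [← ENNReal.ofReal_mul (by norm_num), ← ENNReal.ofReal_mul (by positivity),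
        ← ENNReal.ofReal_mul (by ring_nf; positivity), ← ENNReal.ofReal_one]
      congr 1
      field_simp
      ring
    calc _ = vhat v (1 - x / 4) * ((vhat v (1 - x))⁻¹ * vhat v (1 - x)) *
          (ENNReal.ofReal 2 * ENNReal.ofReal (1 / (x / 2) ^ 2) *
        ENNReal.ofReal ((1 - x / 4) - (1 - x / 2)) * ENNReal.ofReal ((1 - x / 2) - (1 - x))) := by
          rw [this, ENNReal.inv_mul_cancel hn ht]; simp
      _ = _ := by rw [ENNReal.ofReal_ofNat]; ring
  rw [e4]
  gcongr

/-- `M₁` is bounded below by an absolute constant: if it were too small, the tail would decay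
faster than `(1 - r)³`, and the dual weight would not be integrable. -/
lemma one_le_sq_M₁ {v : ℂ → ℝ} (hv : MemDHat v) (hI : IntegrabilityCondition v) :
    1 ≤ 128 * M₁ v ^ 2 := by
  by_contra! hlt
  have hit : ∀ n : ℕ, vhat v (1 - (1 / 4) ^ n) ≤ (2 * M₁ v ^ 2) ^ n * vhat v 0 := by
    intro n
    induction n with
    | zero => simp
    | succ n ih =>
      have := vhat_le_mul_sq_M₁ hv (x := (1 / 4) ^ n) (by positivity)
        (pow_le_one₀ (by norm_num) (by norm_num))
      calc vhat v (1 - (1 / 4) ^ (n + 1)) = vhat v (1 - (1 / 4) ^ n / 4) := by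
            congr 1; ring
        _ ≤ _ := this
        _ ≤ 2 * M₁ v ^ 2 * ((2 * M₁ v ^ 2) ^ n * vhat v 0) := by gcongr
        _ = _ := by ring
  have hlow : ∀ n : ℕ, 1 ≤ (8 * dualTail v 0 * vhat v 0) * (128 * M₁ v ^ 2) ^ n := by
    intro n
    set x : ℝ := (1 / 4) ^ n with hx
    have hx0 : 0 < x := by positivity
    have hx1 : x ≤ 1 := pow_le_one₀ (by norm_num) (by norm_num)
    have hn := vhat_ne_zero hv.1 (show 0 ≤ 1 - x by linarith) (by linarith)
    have ht := vhat_ne_top hv (show 0 ≤ 1 - x by linarith)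
    have e1 : (ENNReal.ofReal ((x / 2) ^ 2) * (vhat v (1 - x))⁻¹) *
        ENNReal.ofReal ((1 - x / 2) - (1 - x)) ≤ dualTail v 0 := by
      refine le_trans (mul_ofReal_le_setLIntegral
        (f := fun s ↦ ENNReal.ofReal ((1 - s) ^ 2) * (vhat v s)⁻¹) fun s hs ↦ ?_)
        (lintegral_mono_set (Ioo_subset_Ioo (by linarith) (by linarith)))
      have := hs.2
      gcongr
      · linarith
      · exact vhat_antitone v hs.1.le
    have e2 : ENNReal.ofReal (x ^ 3) ≤ 8 * dualTail v 0 * vhat v (1 - x) := by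
      calc ENNReal.ofReal (x ^ 3) = ENNReal.ofReal 8 * ENNReal.ofReal ((x / 2) ^ 2) *
            ENNReal.ofReal ((1 - x / 2) - (1 - x)) := by
            rw [← ENNReal.ofReal_mul (by norm_num), ← ENNReal.ofReal_mul (by positivity)]
            congr 1; ring
        _ = 8 * ((ENNReal.ofReal ((x / 2) ^ 2) * (vhat v (1 - x))⁻¹) *
            ENNReal.ofReal ((1 - x / 2) - (1 - x))) * vhat v (1 - x) := by
            rw [ENNReal.ofReal_ofNat]
            calc _ = (8 * ENNReal.ofReal ((x / 2) ^ 2) *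
                  ENNReal.ofReal ((1 - x / 2) - (1 - x))) *
                  ((vhat v (1 - x))⁻¹ * vhat v (1 - x)) := by
                  rw [ENNReal.inv_mul_cancel hn ht, mul_one]
              _ = _ := by ring
        _ ≤ _ := by gcongr
    calc (1 : ℝ≥0∞) = ENNReal.ofReal (x ^ 3) * 64 ^ n := by
          rw [show (64 : ℝ≥0∞) = ENNReal.ofReal 64 by simp, ← ENNReal.ofReal_pow (by norm_num),
            ← ENNReal.ofReal_mul (by positivity), ← ENNReal.ofReal_one, hx, ← pow_mul, mul_comm n 3,
            pow_mul, ← mul_pow]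
          norm_num
      _ ≤ (8 * dualTail v 0 * ((2 * M₁ v ^ 2) ^ n * vhat v 0)) * 64 ^ n := by
          gcongr
          exact e2.trans (by gcongr; exact hit n)
      _ = (8 * dualTail v 0 * vhat v 0) * ((2 * M₁ v ^ 2) * 64) ^ n := by
          rw [mul_pow (2 * M₁ v ^ 2) 64]; ring
      _ = _ := by ring
  have hfin : 8 * dualTail v 0 * vhat v 0 ≠ ∞ :=
    ENNReal.mul_ne_top (ENNReal.mul_ne_top (by simp) (hI.dualTail_ne_top le_rfl))
      (vhat_ne_top hv le_rfl)
  have hlim := ENNReal.Tendsto.const_mul (ENNReal.tendsto_pow_atTop_nhds_zero_of_lt_one hlt)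
    (Or.inr hfin)
  rw [mul_zero] at hlim
  have := ge_of_tendsto' hlim hlow
  simp at this

/-! ### The space of symbols -/

/-- The squared norm of `L²_{V̂₂}`. -/
def symbolEnergy (v : ℂ → ℝ) (φ : ℝ → ℂ) : ℝ≥0∞ :=
  ∫⁻ s in Ioo (0 : ℝ) 1, ‖φ s‖ₑ ^ 2 * (vhat v s * ENNReal.ofReal (1 / (1 - s) ^ 2))

lemma Vhat_two_eq {v : ℂ → ℝ} {s : ℝ} (hs : s < 1) :
    Vhat v 2 s = vhat v s * ENNReal.ofReal (1 / (1 - s) ^ 2) := by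
  rw [Vhat, ENNReal.rpow_two, ofReal_one_sub_pow_div hs]

lemma measurable_Vhat_two (v : ℂ → ℝ) : Measurable (Vhat v 2) := by
  unfold Vhat
  fun_prop

lemma aemeasurable_of_measV2 {v : ℂ → ℝ} (hv : IsRadialWeight v) {φ : ℝ → ℂ}
    (h : AEStronglyMeasurable φ (measV2 v)) : AEMeasurable φ (volume.restrict (Ioo 0 1)) := by
  refine h.aemeasurable.mono_ac (withDensity_absolutelyContinuous'
    (measurable_Vhat_two v).aemeasurable ?_)
  filter_upwards [self_mem_ae_restrict measurableSet_Ioo] with s hs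
  rw [Vhat_two_eq hs.2, mul_ne_zero_iff]
  refine ⟨vhat_ne_zero hv hs.1.le hs.2, ?_⟩
  have : 0 < 1 - s := by linarith [hs.2]
  simp only [ne_eq, ENNReal.ofReal_eq_zero, not_le]
  positivity

lemma eLpNorm_eq {v : ℂ → ℝ} {φ : ℝ → ℂ} (h : AEMeasurable φ (volume.restrict (Ioo 0 1))) :
    eLpNorm φ 2 (measV2 v) = symbolEnergy v φ ^ (1 / 2 : ℝ) := by
  rw [eLpNorm_eq_lintegral_rpow_enorm_toReal (by norm_num) (by norm_num), measV2,
    lintegral_withDensity_eq_lintegral_mul₀ (measurable_Vhat_two v).aemeasurable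
      (by fun_prop)]
  simp only [ENNReal.toReal_ofNat, ENNReal.rpow_two, Pi.mul_apply]
  congr 1
  refine setLIntegral_congr_fun measurableSet_Ioo fun s hs ↦ ?_
  rw [Vhat_two_eq hs.2, mul_comm]

/-- The dual weight is the inverse of `V̂₂`. -/
lemma inv_weight_eq {v : ℂ → ℝ} (hv : MemDHat v) {s : ℝ} (h0 : 0 ≤ s) (h1 : s < 1) :
    (vhat v s * ENNReal.ofReal (1 / (1 - s) ^ 2))⁻¹ =
      ENNReal.ofReal ((1 - s) ^ 2) * (vhat v s)⁻¹ := by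
  have : 0 < 1 - s := by linarith
  rw [ENNReal.mul_inv (Or.inr (by finiteness)) (Or.inl (vhat_ne_top hv h0)),
    ← ENNReal.ofReal_inv_of_pos (by positivity), one_div, inv_inv, mul_comm]

lemma sq_absMoment_zero_le {v : ℂ → ℝ} (hv : MemDHat v) {φ : ℝ → ℂ}
    (h : AEMeasurable φ (volume.restrict (Ioo 0 1))) :
    absMoment φ 0 ^ 2 ≤ symbolEnergy v φ * dualTail v 0 := by
  have h1 := sq_lintegral_le_weighted (volume.restrict (Ioo (0 : ℝ) 1)) (g := fun s ↦ ‖φ s‖ₑ)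
    (s := fun s ↦ vhat v s * ENNReal.ofReal (1 / (1 - s) ^ 2)) (by fun_prop) (by fun_prop) (by
      filter_upwards [self_mem_ae_restrict measurableSet_Ioo] with s hs
      have : 0 < 1 - s := by linarith [hs.2]
      refine ⟨mul_ne_zero (vhat_ne_zero hv.1 hs.1.le hs.2) ?_,
        ENNReal.mul_ne_top (vhat_ne_top hv hs.1.le) (by finiteness)⟩
      simp only [ne_eq, ENNReal.ofReal_eq_zero, not_le]
      positivity)
  rw [setLIntegral_congr_fun measurableSet_Ioo
    fun s hs ↦ inv_weight_eq hv hs.1.le hs.2] at h1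
  simpa only [absMoment, symbolEnergy, dualTail, pow_zero, mul_one] using h1

lemma integrableOn_of_memLp {v : ℂ → ℝ} (hv : MemDHat v) (hI : IntegrabilityCondition v)
    {φ : ℝ → ℂ} (h : MemLp φ 2 (measV2 v)) : IntegrableOn φ (Ioo 0 1) := by
  have hm := aemeasurable_of_measV2 hv.1 h.1
  refine ⟨hm.aestronglyMeasurable, ?_⟩
  have h1 := sq_absMoment_zero_le hv hm
  have h2 : symbolEnergy v φ ≠ ∞ := by
    have := h.2.ne
    rw [eLpNorm_eq hm] at this
    intro h3
    simp [h3] at this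
  have h3 : absMoment φ 0 ^ 2 < ∞ :=
    h1.trans_lt (ENNReal.mul_ne_top h2 (hI.dualTail_ne_top le_rfl)).lt_top
  have h4 : absMoment φ 0 < ∞ := by
    by_contra h5
    rw [not_lt, top_le_iff] at h5
    simp [h5] at h3
  simpa only [HasFiniteIntegral, absMoment, pow_zero, mul_one] using h4

/-! ### Weighted Hardy inequalities on the unit interval -/

lemma ne_zero_and_ne_top_of_mul_le {a b B : ℝ≥0∞} (ha : a ≠ 0) (hb : b ≠ 0) (hB : B ≠ ∞)
    (h : a * b ≤ B) : (a ≠ 0 ∧ a ≠ ∞) ∧ (b ≠ 0 ∧ b ≠ ∞) := by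
  refine ⟨⟨ha, ?_⟩, hb, ?_⟩
  · rintro rfl
    rw [ENNReal.top_mul hb, top_le_iff] at h
    exact hB h
  · rintro rfl
    rw [ENNReal.mul_top ha, top_le_iff] at h
    exact hB h

lemma restrict_Ioo_restrict_Iio {r : ℝ} (hr : r ∈ Ioo (0 : ℝ) 1) :
    (volume.restrict (Ioo (0 : ℝ) 1)).restrict (Iio r) = volume.restrict (Ioo 0 r) := by
  rw [Measure.restrict_restrict measurableSet_Iio]
  congr 1
  ext x; simp only [mem_inter_iff, mem_Iio, mem_Ioo]
  exact ⟨fun h ↦ ⟨h.2.1, h.1⟩, fun h ↦ ⟨h.2, h.1, h.2.trans hr.2⟩⟩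

lemma restrict_Ioo_restrict_Ioi {r : ℝ} (hr : r ∈ Ioo (0 : ℝ) 1) :
    (volume.restrict (Ioo (0 : ℝ) 1)).restrict (Ioi r) = volume.restrict (Ioo r 1) := by
  rw [Measure.restrict_restrict measurableSet_Ioi]
  congr 1
  ext x; simp only [mem_inter_iff, mem_Ioi, mem_Ioo]
  exact ⟨fun h ↦ ⟨h.1, h.2.2⟩, fun h ↦ ⟨h.1, hr.1.trans h.1, h.2⟩⟩

/-- `hardy_Iio` for the measures `u dr` and `w dt` on `(0, 1)`; the finiteness that it asks for
follows from `B < ∞` and positivity. -/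
lemma hardy_weighted_left {u w f : ℝ → ℝ≥0∞} (hu : Measurable u) (hw : Measurable w)
    (hf : Measurable f) {B : ℝ≥0∞} (hB : B ≠ ∞) (hu0 : ∀ t ∈ Ioo (0 : ℝ) 1, u t ≠ 0)
    (hw0 : ∀ t ∈ Ioo (0 : ℝ) 1, w t ≠ 0)
    (h : ∀ r ∈ Ioo (0 : ℝ) 1, (∫⁻ t in Ioo 0 r, w t) * (∫⁻ t in Ioo r 1, u t) ≤ B) :
    ∫⁻ r in Ioo (0 : ℝ) 1, u r * (∫⁻ t in Ioo 0 r, w t * f t) ^ 2 ≤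
      4 * B * ∫⁻ t in Ioo (0 : ℝ) 1, w t * f t ^ 2 := by
  set m : Measure ℝ := volume.restrict (Ioo 0 1) with hm
  have hν : ∀ r ∈ Ioo (0 : ℝ) 1, m.withDensity w (Iio r) = ∫⁻ t in Ioo 0 r, w t := by
    intro r hr; rw [withDensity_apply _ measurableSet_Iio,
    restrict_Ioo_restrict_Iio hr]
  have hμ : ∀ r ∈ Ioo (0 : ℝ) 1, m.withDensity u (Ioi r) = ∫⁻ t in Ioo r 1, u t := by
    intro r hr; rw [withDensity_apply _ measurableSet_Ioi,
    restrict_Ioo_restrict_Ioi hr]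
  have hp : ∀ r ∈ Ioo (0 : ℝ) 1,
      (m.withDensity w (Iio r) ≠ 0 ∧ m.withDensity w (Iio r) ≠ ∞) ∧
      (m.withDensity u (Ioi r) ≠ 0 ∧ m.withDensity u (Ioi r) ≠ ∞) := by
    intro r hr
    rw [hν r hr, hμ r hr]
    refine ne_zero_and_ne_top_of_mul_le ?_ ?_ hB (h r hr)
    · exact setLIntegral_Ioo_ne_zero hr.1 hw.aemeasurable
        fun s hs ↦ hw0 s ⟨hs.1, hs.2.trans hr.2⟩
    · exact setLIntegral_Ioo_ne_zero hr.2 hu.aemeasurable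
        fun s hs ↦ hu0 s ⟨hr.1.trans hs.1, hs.2⟩
  have hpB : ∀ r ∈ Ioo (0 : ℝ) 1, m.withDensity w (Iio r) * m.withDensity u (Ioi r) ≤ B := by
    intro r hr; rw [hν r hr, hμ r hr]; exact h r hr
  have hmem : ∀ k : ℝ → ℝ≥0∞, ∀ᵐ t ∂(m.withDensity k), t ∈ Ioo (0 : ℝ) 1 := fun k ↦
    (withDensity_absolutelyContinuous m k).ae_le (self_mem_ae_restrict measurableSet_Ioo)
  have key := hardy_Iio (m.withDensity u) (m.withDensity w) hf
    ((hmem w).mono fun t ht ↦ (hp t ht).1) ((hmem u).mono fun t ht ↦ (hp t ht).2)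
    ((hmem w).mono hpB) ((hmem u).mono hpB)
  have hmono : Monotone fun r ↦ ∫⁻ t in Iio r, f t ∂(m.withDensity w) :=
    fun a b hab ↦ lintegral_mono_set (Iio_subset_Iio hab)
  rw [lintegral_withDensity_eq_lintegral_mul _ hu (hmono.measurable.pow_const 2),
    lintegral_withDensity_eq_lintegral_mul _ hw (hf.pow_const 2)] at key
  refine le_trans (le_of_eq ?_) key
  refine setLIntegral_congr_fun measurableSet_Ioo fun r hr ↦ ?_
  simp only [Pi.mul_apply]
  rw [setLIntegral_withDensity_eq_setLIntegral_mul _ hw hf measurableSet_Iio,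
    restrict_Ioo_restrict_Iio hr]
  rfl

/-- `hardy_Ioi` for the measures `u dr` and `w dt` on `(0, 1)`. -/
lemma hardy_weighted_right {u w f : ℝ → ℝ≥0∞} (hu : Measurable u) (hw : Measurable w)
    (hf : Measurable f) {B : ℝ≥0∞} (hB : B ≠ ∞) (hu0 : ∀ t ∈ Ioo (0 : ℝ) 1, u t ≠ 0)
    (hw0 : ∀ t ∈ Ioo (0 : ℝ) 1, w t ≠ 0)
    (h : ∀ r ∈ Ioo (0 : ℝ) 1, (∫⁻ t in Ioo r 1, w t) * (∫⁻ t in Ioo 0 r, u t) ≤ B) :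
    ∫⁻ r in Ioo (0 : ℝ) 1, u r * (∫⁻ t in Ioo r 1, w t * f t) ^ 2 ≤
      4 * B * ∫⁻ t in Ioo (0 : ℝ) 1, w t * f t ^ 2 := by
  set m : Measure ℝ := volume.restrict (Ioo 0 1) with hm
  have hν : ∀ r ∈ Ioo (0 : ℝ) 1, m.withDensity w (Ioi r) = ∫⁻ t in Ioo r 1, w t := by
    intro r hr; rw [withDensity_apply _ measurableSet_Ioi,
    restrict_Ioo_restrict_Ioi hr]
  have hμ : ∀ r ∈ Ioo (0 : ℝ) 1, m.withDensity u (Iio r) = ∫⁻ t in Ioo 0 r, u t := by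
    intro r hr; rw [withDensity_apply _ measurableSet_Iio,
    restrict_Ioo_restrict_Iio hr]
  have hp : ∀ r ∈ Ioo (0 : ℝ) 1,
      (m.withDensity w (Ioi r) ≠ 0 ∧ m.withDensity w (Ioi r) ≠ ∞) ∧
      (m.withDensity u (Iio r) ≠ 0 ∧ m.withDensity u (Iio r) ≠ ∞) := by
    intro r hr
    rw [hν r hr, hμ r hr]
    refine ne_zero_and_ne_top_of_mul_le ?_ ?_ hB (h r hr)
    · exact setLIntegral_Ioo_ne_zero hr.2 hw.aemeasurable
        fun s hs ↦ hw0 s ⟨hr.1.trans hs.1, hs.2⟩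
    · exact setLIntegral_Ioo_ne_zero hr.1 hu.aemeasurable
        fun s hs ↦ hu0 s ⟨hs.1, hs.2.trans hr.2⟩
  have hpB : ∀ r ∈ Ioo (0 : ℝ) 1, m.withDensity w (Ioi r) * m.withDensity u (Iio r) ≤ B := by
    intro r hr; rw [hν r hr, hμ r hr]; exact h r hr
  have hmem : ∀ k : ℝ → ℝ≥0∞, ∀ᵐ t ∂(m.withDensity k), t ∈ Ioo (0 : ℝ) 1 := fun k ↦
    (withDensity_absolutelyContinuous m k).ae_le (self_mem_ae_restrict measurableSet_Ioo)
  have key := hardy_Ioi (m.withDensity u) (m.withDensity w) hf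
    ((hmem w).mono fun t ht ↦ (hp t ht).1) ((hmem u).mono fun t ht ↦ (hp t ht).2)
    ((hmem w).mono hpB) ((hmem u).mono hpB)
  have hmono : Antitone fun r ↦ ∫⁻ t in Ioi r, f t ∂(m.withDensity w) :=
    fun a b hab ↦ lintegral_mono_set (Ioi_subset_Ioi hab)
  rw [lintegral_withDensity_eq_lintegral_mul _ hu (hmono.measurable.pow_const 2),
    lintegral_withDensity_eq_lintegral_mul _ hw (hf.pow_const 2)] at key
  refine le_trans (le_of_eq ?_) key
  refine setLIntegral_congr_fun measurableSet_Ioo fun r hr ↦ ?_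
  simp only [Pi.mul_apply]
  rw [setLIntegral_withDensity_eq_setLIntegral_mul _ hw hf measurableSet_Ioi,
    restrict_Ioo_restrict_Ioi hr]
  rfl

lemma ofReal_one_div_one_sub_pow_ne_zero {s : ℝ} (hs : s < 1) (k : ℕ) :
    ENNReal.ofReal (1 / (1 - s) ^ k) ≠ 0 := by
  have : 0 < 1 - s := by linarith
  simp only [ne_eq, ENNReal.ofReal_eq_zero, not_le]
  positivity

/-- Hardy's inequality governed by `M₁`. -/
lemma lintegral_vhat_mul_sq_left_le {v : ℂ → ℝ} (hv : MemDHat v) (hM : M₁ v < ∞)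
    {g : ℝ → ℝ≥0∞} (hg : Measurable g) :
    ∫⁻ r in Ioo (0 : ℝ) 1, vhat v r *
      (∫⁻ t in Ioo 0 r, g t * ENNReal.ofReal (1 / (1 - t) ^ 2)) ^ 2 ≤
      4 * M₁ v ^ 2 * ∫⁻ t in Ioo (0 : ℝ) 1,
        g t ^ 2 * (vhat v t * ENNReal.ofReal (1 / (1 - t) ^ 2)) := by
  have hcancel : ∀ t ∈ Ioo (0 : ℝ) 1, (vhat v t)⁻¹ * vhat v t = 1 := fun t ht ↦
    ENNReal.inv_mul_cancel (vhat_ne_zero hv.1 ht.1.le ht.2) (vhat_ne_top hv ht.1.le)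
  have key := hardy_weighted_left (u := vhat v)
    (w := fun t ↦ (vhat v t)⁻¹ * ENNReal.ofReal (1 / (1 - t) ^ 2))
    (f := fun t ↦ g t * vhat v t) (by fun_prop) (by fun_prop) (by fun_prop)
    (B := M₁ v ^ 2) (by finiteness) (fun t ht ↦ vhat_ne_zero hv.1 ht.1.le ht.2)
    (fun t ht ↦ mul_ne_zero (ENNReal.inv_ne_zero.2 (vhat_ne_top hv ht.1.le))
      (ofReal_one_div_one_sub_pow_ne_zero ht.2 2)) (fun r hr ↦ ?_)
  · refine le_trans (le_of_eq ?_) (key.trans (le_of_eq ?_))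
    · refine setLIntegral_congr_fun measurableSet_Ioo fun r hr ↦ ?_
      congr 2
      refine setLIntegral_congr_fun measurableSet_Ioo fun t ht ↦ ?_
      have ht' : t ∈ Ioo (0 : ℝ) 1 := ⟨ht.1, ht.2.trans hr.2⟩
      calc g t * ENNReal.ofReal (1 / (1 - t) ^ 2)
          = ((vhat v t)⁻¹ * vhat v t) * (g t * ENNReal.ofReal (1 / (1 - t) ^ 2)) := by
            rw [hcancel t ht', one_mul]
        _ = _ := by ring
    · congr 1
      refine setLIntegral_congr_fun measurableSet_Ioo fun t ht ↦ ?_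
      calc _ = ((vhat v t)⁻¹ * vhat v t) *
            (g t ^ 2 * (vhat v t * ENNReal.ofReal (1 / (1 - t) ^ 2))) := by ring
        _ = _ := by rw [hcancel t ht, one_mul]
  · -- the weight `(1 - t)⁻²` moves from one factor to the other, by monotonicity
    have h1r : 0 < 1 - r := by linarith [hr.2]
    have a1 : ∫⁻ t in Ioo 0 r, (vhat v t)⁻¹ * ENNReal.ofReal (1 / (1 - t) ^ 2) ≤
        (∫⁻ t in Ioo 0 r, (vhat v t)⁻¹) * ENNReal.ofReal (1 / (1 - r) ^ 2) := by
      rw [← lintegral_mul_const _ (by fun_prop)]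
      refine setLIntegral_mono' measurableSet_Ioo fun t ht ↦ ?_
      have := ht.2
      gcongr
    have a2 : ENNReal.ofReal (1 / (1 - r) ^ 2) * ∫⁻ t in Ioo r 1, vhat v t ≤
        ∫⁻ s in Ioo r 1, vhat v s * ENNReal.ofReal (1 / (1 - s) ^ 2) := by
      rw [← lintegral_const_mul _ (by fun_prop)]
      refine setLIntegral_mono' measurableSet_Ioo fun t ht ↦ ?_
      have h1 := ht.1
      have h2 : 0 < 1 - t := by linarith [ht.2]
      rw [mul_comm]
      gcongr
    calc _ ≤ ((∫⁻ t in Ioo 0 r, (vhat v t)⁻¹) * ENNReal.ofReal (1 / (1 - r) ^ 2)) *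
          ∫⁻ t in Ioo r 1, vhat v t := by gcongr
      _ = (ENNReal.ofReal (1 / (1 - r) ^ 2) * ∫⁻ t in Ioo r 1, vhat v t) *
          ∫⁻ t in Ioo 0 r, (vhat v t)⁻¹ := by ring
      _ ≤ _ := by gcongr
      _ ≤ _ := mul_le_sq_M₁ v hr

/-- Hardy's inequality governed by `M₂`. -/
lemma lintegral_vhat_mul_sq_right_le {v : ℂ → ℝ} (hv : MemDHat v) (hM : M₂ v < ∞)
    {g : ℝ → ℝ≥0∞} (hg : Measurable g) :
    ∫⁻ r in Ioo (0 : ℝ) 1, vhat v r *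
      (ENNReal.ofReal (1 / (1 - r) ^ 2) * ∫⁻ t in Ioo r 1, g t) ^ 2 ≤
      4 * M₂ v ^ 2 * ∫⁻ t in Ioo (0 : ℝ) 1,
        g t ^ 2 * (vhat v t * ENNReal.ofReal (1 / (1 - t) ^ 2)) := by
  have hcancel : ∀ t ∈ Ioo (0 : ℝ) 1, (ENNReal.ofReal ((1 - t) ^ 2) * (vhat v t)⁻¹) *
      (vhat v t * ENNReal.ofReal (1 / (1 - t) ^ 2)) = 1 := fun t ht ↦ by
    rw [← inv_weight_eq hv ht.1.le ht.2]
    exact ENNReal.inv_mul_cancel (mul_ne_zero (vhat_ne_zero hv.1 ht.1.le ht.2)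
      (ofReal_one_div_one_sub_pow_ne_zero ht.2 2))
      (ENNReal.mul_ne_top (vhat_ne_top hv ht.1.le) (by finiteness))
  have key := hardy_weighted_right (u := fun r ↦ vhat v r * ENNReal.ofReal (1 / (1 - r) ^ 4))
    (w := fun t ↦ ENNReal.ofReal ((1 - t) ^ 2) * (vhat v t)⁻¹)
    (f := fun t ↦ g t * (vhat v t * ENNReal.ofReal (1 / (1 - t) ^ 2)))
    (by fun_prop) (by fun_prop) (by fun_prop)
    (B := M₂ v ^ 2) (by finiteness)
    (fun t ht ↦ mul_ne_zero (vhat_ne_zero hv.1 ht.1.le ht.2)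
      (ofReal_one_div_one_sub_pow_ne_zero ht.2 4))
    (fun t ht ↦ left_ne_zero_of_mul_eq_one (hcancel t ht)) (fun r hr ↦ ?_)
  · refine le_trans (le_of_eq ?_) (key.trans (le_of_eq ?_))
    · refine setLIntegral_congr_fun measurableSet_Ioo fun r hr ↦ ?_
      have h1r : 0 < 1 - r := by linarith [hr.2]
      rw [mul_pow, ← ENNReal.ofReal_pow (by positivity), mul_assoc]
      congr 2
      · congr 1
        field_simp
      · congr 1
        refine setLIntegral_congr_fun measurableSet_Ioo fun t ht ↦ ?_
        have ht' : t ∈ Ioo (0 : ℝ) 1 := ⟨hr.1.trans ht.1, ht.2⟩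
        calc g t = g t * 1 := (mul_one _).symm
          _ = _ := by rw [← hcancel t ht']; ring
    · congr 1
      refine setLIntegral_congr_fun measurableSet_Ioo fun t ht ↦ ?_
      calc _ = ((ENNReal.ofReal ((1 - t) ^ 2) * (vhat v t)⁻¹) *
            (vhat v t * ENNReal.ofReal (1 / (1 - t) ^ 2))) *
            (g t ^ 2 * (vhat v t * ENNReal.ofReal (1 / (1 - t) ^ 2))) := by ring
        _ = _ := by rw [hcancel t ht, one_mul]
  · rw [mul_comm]
    exact mul_le_sq_M₂ v hr

/-! ### The upper bound -/

lemma tsum_choose_two_mul_pow {x : ℝ} (h0 : 0 ≤ x) (h1 : x < 1) :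
    ∑' n : ℕ, ENNReal.ofReal (((n + 2).choose 2 : ℕ) * x ^ n) =
      ENNReal.ofReal (1 / (1 - x) ^ 3) := by
  have hx : ‖x‖ < 1 := by rwa [Real.norm_of_nonneg h0]
  have h := hasSum_choose_mul_geometric_of_norm_lt_one 2 hx
  rw [← ENNReal.ofReal_tsum_of_nonneg (fun n ↦ by positivity) h.summable, h.tsum_eq]

lemma ofReal_choose_two (n : ℕ) :
    (((n + 2).choose 2 : ℕ) : ℝ) = ((n : ℝ) + 1) * (n + 2) / 2 := by
  rw [Nat.cast_choose_two]; push_cast; ring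

lemma tsum_sq_succ_mul_pow_le {x : ℝ} (h0 : 0 ≤ x) (h1 : x < 1) :
    ∑' n : ℕ, ((n : ℝ≥0∞) + 1) ^ 2 * ENNReal.ofReal x ^ n ≤
      2 * ENNReal.ofReal (1 / (1 - x) ^ 3) := by
  rw [← tsum_choose_two_mul_pow h0 h1, ← ENNReal.tsum_mul_left]
  refine ENNReal.tsum_le_tsum fun n ↦ ?_
  rw [show ((n : ℝ≥0∞) + 1) = ENNReal.ofReal ((n : ℝ) + 1) by
      rw [ENNReal.ofReal_add (by positivity) (by norm_num)]; simp,
    show (2 : ℝ≥0∞) = ENNReal.ofReal 2 by simp, ← ENNReal.ofReal_pow (by positivity),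
    ← ENNReal.ofReal_pow h0, ← ENNReal.ofReal_mul (by positivity),
    ← ENNReal.ofReal_mul (by positivity), ofReal_choose_two, ← mul_assoc]
  refine ENNReal.ofReal_le_ofReal (mul_le_mul_of_nonneg_right ?_ (by positivity))
  nlinarith [(n.cast_nonneg : (0 : ℝ) ≤ n)]

lemma le_tsum_sq_succ_mul_pow {x : ℝ} (h0 : 0 ≤ x) (h1 : x < 1) :
    ENNReal.ofReal (1 / (1 - x) ^ 3) ≤
      ∑' n : ℕ, ((n : ℝ≥0∞) + 1) ^ 2 * ENNReal.ofReal x ^ n := by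
  rw [← tsum_choose_two_mul_pow h0 h1]
  refine ENNReal.tsum_le_tsum fun n ↦ ?_
  rw [show ((n : ℝ≥0∞) + 1) = ENNReal.ofReal ((n : ℝ) + 1) by
      rw [ENNReal.ofReal_add (by positivity) (by norm_num)]; simp,
    ← ENNReal.ofReal_pow (by positivity),
    ← ENNReal.ofReal_pow h0, ← ENNReal.ofReal_mul (by positivity), ofReal_choose_two]
  refine ENNReal.ofReal_le_ofReal (mul_le_mul_of_nonneg_right ?_ (by positivity))
  nlinarith [(n.cast_nonneg : (0 : ℝ) ≤ n)]

/-- Integration of `d/dρ (1 - c ρ²)⁻³ = 6 c ρ (1 - c ρ²)⁻⁴`, followed by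
`1 - t s ρ² ≥ max (1 - t ρ) (1 - s ρ)`. -/
lemma one_div_cube_le {t s r : ℝ} (ht : t ∈ Ioo (0 : ℝ) 1) (hs : s ∈ Ioo (0 : ℝ) 1)
    (hr : r ∈ Ioo (0 : ℝ) 1) :
    ENNReal.ofReal (1 / (1 - t * s * r ^ 2) ^ 3) ≤
      1 + 6 * ∫⁻ ρ in Ioo 0 r, ENNReal.ofReal (1 / (1 - t * ρ) ^ 2) *
        ENNReal.ofReal (1 / (1 - s * ρ) ^ 2) := by
  set c := t * s with hc
  have hc0 : 0 < c := mul_pos ht.1 hs.1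
  have hct : c ≤ t := by nlinarith [ht.1, hs.2]
  have hcs : c ≤ s := by nlinarith [hs.1, ht.2]
  have hpos : ∀ ρ ∈ Icc (0 : ℝ) r, 0 < 1 - c * ρ ^ 2 := by
    intro ρ hρ
    have h1 : ρ ^ 2 < 1 := by nlinarith [hρ.1, hρ.2, hr.2]
    nlinarith [ht.2]
  have hcont : ContinuousOn (fun ρ : ℝ ↦ 6 * c * ρ / (1 - c * ρ ^ 2) ^ 4) (Icc 0 r) :=
    ContinuousOn.div (by fun_prop) (by fun_prop) fun ρ hρ ↦ (pow_pos (hpos ρ hρ) 4).ne'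
  have hint : IntervalIntegrable (fun ρ : ℝ ↦ 6 * c * ρ / (1 - c * ρ ^ 2) ^ 4) volume 0 r := by
    apply ContinuousOn.intervalIntegrable
    rwa [uIcc_of_le hr.1.le]
  have hFTC : ∫ ρ in (0 : ℝ)..r, 6 * c * ρ / (1 - c * ρ ^ 2) ^ 4 =
      1 / (1 - c * r ^ 2) ^ 3 - 1 / (1 - c * 0 ^ 2) ^ 3 := by
    refine intervalIntegral.integral_eq_sub_of_hasDerivAt
      (f := fun ρ ↦ 1 / (1 - c * ρ ^ 2) ^ 3) (fun ρ hρ ↦ ?_) hint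
    rw [uIcc_of_le hr.1.le] at hρ
    have h0 := hpos ρ hρ
    have h1 : HasDerivAt (fun ρ : ℝ ↦ (1 - c * ρ ^ 2) ^ 3)
        (3 * (1 - c * ρ ^ 2) ^ 2 * (-(c * (2 * ρ)))) ρ := by
      have := ((((hasDerivAt_id ρ).fun_pow 2).const_mul c).const_sub 1).fun_pow 3
      simpa using this
    have h2 := h1.fun_inv (pow_pos h0 3).ne'
    simp only [one_div]
    refine h2.congr_deriv ?_
    field_simp
    ring
  have hkey : 1 / (1 - c * r ^ 2) ^ 3 =
      1 + ∫ ρ in Ioo 0 r, 6 * c * ρ / (1 - c * ρ ^ 2) ^ 4 := by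
    rw [← integral_Ioc_eq_integral_Ioo, ← intervalIntegral.integral_of_le hr.1.le, hFTC]
    simp
  have hnn : ∀ ρ ∈ Ioo 0 r, 0 ≤ 6 * c * ρ / (1 - c * ρ ^ 2) ^ 4 := fun ρ hρ ↦ by
    have := hpos ρ (Ioo_subset_Icc_self hρ)
    have := hρ.1
    positivity
  rw [hkey, ENNReal.ofReal_add (by norm_num) (setIntegral_nonneg measurableSet_Ioo hnn),
    ENNReal.ofReal_one, ofReal_integral_eq_lintegral_ofReal
    (hcont.integrableOn_Icc.mono_set Ioo_subset_Icc_self)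
    (by filter_upwards [self_mem_ae_restrict measurableSet_Ioo] with ρ hρ using hnn ρ hρ),
    ← lintegral_const_mul' _ _ (by simp)]
  gcongr 1 + ?_
  refine setLIntegral_mono' measurableSet_Ioo fun ρ hρ ↦ ?_
  have h0 := hpos ρ (Ioo_subset_Icc_self hρ)
  have hρ1 : ρ < 1 := hρ.2.trans hr.2
  have htρ : 0 < 1 - t * ρ := by nlinarith [ht.1, ht.2, hρ.1]
  have hsρ : 0 < 1 - s * ρ := by nlinarith [hs.1, hs.2, hρ.1]
  rw [show (6 : ℝ≥0∞) = ENNReal.ofReal 6 by simp, ← ENNReal.ofReal_mul (by positivity),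
    ← ENNReal.ofReal_mul (by positivity)]
  apply ENNReal.ofReal_le_ofReal
  have hcρ : c * ρ ^ 2 ≤ c * ρ :=
    mul_le_mul_of_nonneg_left (by nlinarith [hρ.1]) hc0.le
  have b1 : (1 - t * ρ) ≤ 1 - c * ρ ^ 2 := by nlinarith [hρ.1]
  have b2 : (1 - s * ρ) ≤ 1 - c * ρ ^ 2 := by nlinarith [hρ.1]
  have b3 : (1 - t * ρ) ^ 2 * (1 - s * ρ) ^ 2 ≤ (1 - c * ρ ^ 2) ^ 4 := by
    calc _ ≤ (1 - c * ρ ^ 2) ^ 2 * (1 - c * ρ ^ 2) ^ 2 := by gcongr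
      _ = _ := by ring
  have b4 : c * ρ ≤ 1 := by nlinarith [hρ.1, ht.2]
  calc 6 * c * ρ / (1 - c * ρ ^ 2) ^ 4 ≤ 6 / ((1 - t * ρ) ^ 2 * (1 - s * ρ) ^ 2) := by
        gcongr
        linarith
    _ = _ := by field_simp

/-- The transform `∫_0^1 t g(t) / (1 - t ρ)² dt`, that is, the derivative of the Hilbert transform
of a nonnegative symbol `g` at the point `ρ`. -/
def derivTransform (g : ℝ → ℝ≥0∞) (ρ : ℝ) : ℝ≥0∞ :=
  ∫⁻ t in Ioo (0 : ℝ) 1, g t * ENNReal.ofReal t * ENNReal.ofReal (1 / (1 - t * ρ) ^ 2)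

lemma measurable_derivTransform {g : ℝ → ℝ≥0∞} (hg : Measurable g) :
    Measurable (derivTransform g) := by
  have : Measurable (Function.uncurry fun ρ t : ℝ ↦
      g t * ENNReal.ofReal t * ENNReal.ofReal (1 / (1 - t * ρ) ^ 2)) := by
    unfold Function.uncurry
    fun_prop
  exact this.lintegral_prod_right'

/-- The circle means of the derivative are dominated by radial integrals of the derivative: expand
the square, sum the series under the integral, and use `one_div_cube_le`. -/
lemma tsum_sq_moment_le {g : ℝ → ℝ≥0∞} (hg : Measurable g) {r : ℝ} (hr : r ∈ Ioo (0 : ℝ) 1) :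
    ∑' n : ℕ, ((n : ℝ≥0∞) + 1) ^ 2 *
        (∫⁻ t in Ioo (0 : ℝ) 1, g t * ENNReal.ofReal t ^ (n + 1)) ^ 2 *
        ENNReal.ofReal r ^ (2 * n) ≤
      2 * derivTransform g 0 ^ 2 + 12 * ∫⁻ ρ in Ioo 0 r, derivTransform g ρ ^ 2 := by
  set m : Measure ℝ := volume.restrict (Ioo 0 1) with hm
  set a : ℝ → ℝ≥0∞ := fun t ↦ g t * ENNReal.ofReal t with ha
  have ham : Measurable a := by fun_prop
  have hmem : ∀ᵐ p ∂(m.prod m), p.1 ∈ Ioo (0 : ℝ) 1 ∧ p.2 ∈ Ioo (0 : ℝ) 1 := by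
    rw [hm, Measure.prod_restrict]
    exact self_mem_ae_restrict (measurableSet_Ioo.prod measurableSet_Ioo)
  have h1 : ∀ n : ℕ, ((n : ℝ≥0∞) + 1) ^ 2 *
      (∫⁻ t in Ioo (0 : ℝ) 1, g t * ENNReal.ofReal t ^ (n + 1)) ^ 2 *
      ENNReal.ofReal r ^ (2 * n) = ∫⁻ p, (a p.1 * a p.2) * (((n : ℝ≥0∞) + 1) ^ 2 *
        (ENNReal.ofReal p.1 * ENNReal.ofReal p.2 * ENNReal.ofReal r ^ 2) ^ n) ∂(m.prod m) := by
    intro n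
    have e1 : (∫⁻ t in Ioo (0 : ℝ) 1, g t * ENNReal.ofReal t ^ (n + 1)) ^ 2 =
        ∫⁻ p, (g p.1 * ENNReal.ofReal p.1 ^ (n + 1)) * (g p.2 * ENNReal.ofReal p.2 ^ (n + 1))
          ∂(m.prod m) := by
      rw [sq]
      exact (lintegral_prod_mul (f := fun t ↦ g t * ENNReal.ofReal t ^ (n + 1))
        (g := fun t ↦ g t * ENNReal.ofReal t ^ (n + 1)) (by fun_prop) (by fun_prop)).symm
    rw [e1, ← lintegral_const_mul _ (by fun_prop), ← lintegral_mul_const _ (by fun_prop)]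
    refine lintegral_congr fun p ↦ ?_
    simp only [ha, mul_pow, pow_succ, pow_mul]
    ring
  have h2 : ∀ᵐ p ∂(m.prod m), ∑' n : ℕ, (a p.1 * a p.2) * (((n : ℝ≥0∞) + 1) ^ 2 *
        (ENNReal.ofReal p.1 * ENNReal.ofReal p.2 * ENNReal.ofReal r ^ 2) ^ n) ≤
      2 * (a p.1 * a p.2) + 12 * ∫⁻ ρ in Ioo 0 r,
        (a p.1 * ENNReal.ofReal (1 / (1 - p.1 * ρ) ^ 2)) *
        (a p.2 * ENNReal.ofReal (1 / (1 - p.2 * ρ) ^ 2)) := by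
    filter_upwards [hmem] with p hp
    have hx0 : 0 ≤ p.1 * p.2 * r ^ 2 := mul_nonneg (mul_nonneg hp.1.1.le hp.2.1.le) (sq_nonneg _)
    have hx1 : p.1 * p.2 * r ^ 2 < 1 := by
      have : p.1 * p.2 < 1 := by nlinarith [hp.1.1, hp.1.2, hp.2.1, hp.2.2]
      have : r ^ 2 < 1 := by nlinarith [hr.1, hr.2]
      nlinarith [mul_pos hp.1.1 hp.2.1]
    rw [ENNReal.tsum_mul_left, ← ENNReal.ofReal_pow hr.1.le, ← ENNReal.ofReal_mul hp.1.1.le,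
      ← ENNReal.ofReal_mul (mul_nonneg hp.1.1.le hp.2.1.le)]
    calc _ ≤ (a p.1 * a p.2) * (2 * (1 + 6 * ∫⁻ ρ in Ioo 0 r,
          ENNReal.ofReal (1 / (1 - p.1 * ρ) ^ 2) * ENNReal.ofReal (1 / (1 - p.2 * ρ) ^ 2))) := by
          gcongr
          exact (tsum_sq_succ_mul_pow_le hx0 hx1).trans
            (by gcongr; exact one_div_cube_le hp.1 hp.2 hr)
      _ = 2 * (a p.1 * a p.2) + 12 * ((a p.1 * a p.2) * ∫⁻ ρ in Ioo 0 r,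
          ENNReal.ofReal (1 / (1 - p.1 * ρ) ^ 2) * ENNReal.ofReal (1 / (1 - p.2 * ρ) ^ 2)) := by
          ring
      _ = _ := by
          rw [← lintegral_const_mul _ (by fun_prop)]
          congr 2
          refine lintegral_congr fun ρ ↦ ?_
          ring
  have h3 : ∀ ρ, ∫⁻ p, (a p.1 * ENNReal.ofReal (1 / (1 - p.1 * ρ) ^ 2)) *
      (a p.2 * ENNReal.ofReal (1 / (1 - p.2 * ρ) ^ 2)) ∂(m.prod m) = derivTransform g ρ ^ 2 := by
    intro ρ
    rw [sq]
    exact lintegral_prod_mul (f := fun t ↦ a t * ENNReal.ofReal (1 / (1 - t * ρ) ^ 2))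
      (g := fun t ↦ a t * ENNReal.ofReal (1 / (1 - t * ρ) ^ 2)) (by fun_prop) (by fun_prop)
  have h4 : ∫⁻ p, a p.1 * a p.2 ∂(m.prod m) = derivTransform g 0 ^ 2 := by
    rw [← h3 0]; simp
  have hjoint : Measurable (Function.uncurry fun (p : ℝ × ℝ) (ρ : ℝ) ↦
      (a p.1 * ENNReal.ofReal (1 / (1 - p.1 * ρ) ^ 2)) *
      (a p.2 * ENNReal.ofReal (1 / (1 - p.2 * ρ) ^ 2))) := by
    unfold Function.uncurry
    fun_prop
  refine (tsum_congr h1).trans_le ?_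
  rw [← lintegral_tsum (fun n ↦ by fun_prop)]
  calc _ ≤ ∫⁻ p, (2 * (a p.1 * a p.2) + 12 * ∫⁻ ρ in Ioo 0 r,
        (a p.1 * ENNReal.ofReal (1 / (1 - p.1 * ρ) ^ 2)) *
        (a p.2 * ENNReal.ofReal (1 / (1 - p.2 * ρ) ^ 2))) ∂(m.prod m) := lintegral_mono_ae h2
    _ = 2 * derivTransform g 0 ^ 2 + 12 * ∫⁻ p, (∫⁻ ρ in Ioo 0 r,
        (a p.1 * ENNReal.ofReal (1 / (1 - p.1 * ρ) ^ 2)) *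
        (a p.2 * ENNReal.ofReal (1 / (1 - p.2 * ρ) ^ 2))) ∂(m.prod m) := by
        rw [lintegral_add_left (by fun_prop), lintegral_const_mul _ (by fun_prop), h4,
          lintegral_const_mul' _ _ (by simp)]
    _ = _ := by
        rw [lintegral_lintegral_swap hjoint.aemeasurable]
        simp_rw [h3]

/-- Tonelli's theorem on the triangle `0 < ρ < r < 1`. -/
lemma lintegral_triangle {w h : ℝ → ℝ≥0∞} (hw : AEMeasurable w (volume.restrict (Ioo 0 1)))
    (hh : Measurable h) :
    ∫⁻ r in Ioo (0 : ℝ) 1, w r * ∫⁻ ρ in Ioo 0 r, h ρ =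
      ∫⁻ ρ in Ioo (0 : ℝ) 1, h ρ * ∫⁻ r in Ioo ρ 1, w r := by
  set m : Measure ℝ := volume.restrict (Ioo 0 1) with hm
  have hE : MeasurableSet {p : ℝ × ℝ | p.2 < p.1} :=
    measurableSet_lt measurable_snd measurable_fst
  have e1 : ∀ r ∈ Ioo (0 : ℝ) 1, w r * ∫⁻ ρ in Ioo 0 r, h ρ =
      ∫⁻ ρ, {p : ℝ × ℝ | p.2 < p.1}.indicator (fun p ↦ w p.1 * h p.2) (r, ρ) ∂m := by
    intro r hr
    rw [← restrict_Ioo_restrict_Iio hr, ← lintegral_const_mul _ hh,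
      ← lintegral_indicator measurableSet_Iio]
    rfl
  have e2 : ∀ ρ ∈ Ioo (0 : ℝ) 1, h ρ * ∫⁻ r in Ioo ρ 1, w r =
      ∫⁻ r, {p : ℝ × ℝ | p.2 < p.1}.indicator (fun p ↦ w p.1 * h p.2) (r, ρ) ∂m := by
    intro ρ hρ
    rw [← restrict_Ioo_restrict_Ioi hρ, mul_comm, ← lintegral_mul_const'' _ hw.restrict,
      ← lintegral_indicator measurableSet_Ioi]
    rfl
  rw [setLIntegral_congr_fun measurableSet_Ioo e1, setLIntegral_congr_fun measurableSet_Ioo e2]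
  refine lintegral_lintegral_swap ?_
  refine AEMeasurable.indicator ?_ hE
  exact (hw.comp_quasiMeasurePreserving Measure.quasiMeasurePreserving_fst).mul
    (hh.comp measurable_snd).aemeasurable

lemma derivTransform_zero_le (g : ℝ → ℝ≥0∞) {ρ : ℝ} (hρ : ρ ∈ Ioo (0 : ℝ) 1) :
    derivTransform g 0 ≤ derivTransform g ρ := by
  refine setLIntegral_mono' measurableSet_Ioo fun t ht ↦ ?_
  have h1 : 0 < 1 - t * ρ := by nlinarith [ht.1, ht.2, hρ.1, hρ.2]
  have h2 : 0 < t * ρ := mul_pos ht.1 hρ.1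
  gcongr _ * ENNReal.ofReal ?_
  exact one_div_le_one_div_of_le (by positivity) (pow_le_pow_left₀ h1.le (by linarith) 2)

/-- Splitting at `t = ρ`, with `1 - t ρ ≥ 1 - t` on the left and `1 - t ρ ≥ 1 - ρ` on the right. -/
lemma derivTransform_le {g : ℝ → ℝ≥0∞} (hg : Measurable g) {ρ : ℝ} (hρ : ρ ∈ Ioo (0 : ℝ) 1) :
    derivTransform g ρ ≤ (∫⁻ t in Ioo 0 ρ, g t * ENNReal.ofReal (1 / (1 - t) ^ 2)) +
      ENNReal.ofReal (1 / (1 - ρ) ^ 2) * ∫⁻ t in Ioo ρ 1, g t := by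
  rw [derivTransform, ← Ioc_union_Ioo_eq_Ioo hρ.1.le hρ.2,
    lintegral_union measurableSet_Ioo (by
      rw [Set.disjoint_left]; exact fun x hx hx' ↦ not_lt.2 hx.2 hx'.1),
    setLIntegral_congr Ioo_ae_eq_Ioc.symm, ← lintegral_const_mul _ hg]
  have key : ∀ t ∈ Ioo (0 : ℝ) 1, ∀ u ∈ Ioo (0 : ℝ) 1, t * ρ ≤ u →
      g t * ENNReal.ofReal t * ENNReal.ofReal (1 / (1 - t * ρ) ^ 2) ≤
        g t * ENNReal.ofReal (1 / (1 - u) ^ 2) := by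
    intro t ht u hu h
    have : 0 < 1 - u := by linarith [hu.2]
    calc _ ≤ g t * 1 * ENNReal.ofReal (1 / (1 - u) ^ 2) := by
          gcongr
          rw [← ENNReal.ofReal_one]
          exact ENNReal.ofReal_le_ofReal ht.2.le
      _ = _ := by rw [mul_one]
  gcongr ?_ + ?_
  · refine setLIntegral_mono' measurableSet_Ioo fun t ht ↦ ?_
    have ht' : t ∈ Ioo (0 : ℝ) 1 := ⟨ht.1, ht.2.trans hρ.2⟩
    exact key t ht' t ht' (by nlinarith [ht.1, hρ.2])
  · refine setLIntegral_mono' measurableSet_Ioo fun t ht ↦ ?_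
    have ht' : t ∈ Ioo (0 : ℝ) 1 := ⟨hρ.1.trans ht.1, ht.2⟩
    rw [mul_comm (ENNReal.ofReal _)]
    exact key t ht' ρ hρ (by nlinarith [ht.2, hρ.1])

lemma add_sq_le_two_mul (a b : ℝ≥0∞) : (a + b) ^ 2 ≤ 2 * (a ^ 2 + b ^ 2) := by
  rcases eq_or_ne a ∞ with rfl | ha
  · simp
  rcases eq_or_ne b ∞ with rfl | hb
  · simp
  lift a to ℝ≥0 using ha
  lift b to ℝ≥0 using hb
  exact_mod_cast (add_sq_le : (a + b) ^ 2 ≤ 2 * (a ^ 2 + b ^ 2))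

/-- The energy of a nonnegative symbol is dominated by `∫ F² v̂` with `F = derivTransform g`;
doubling is used only to absorb `v̂(0) F(0)²`. -/
lemma energy_le_derivTransform {v : ℂ → ℝ} (hv : IsRadialWeight v) {K : ℝ≥0}
    (hK : DoublingWith v K) {g : ℝ → ℝ≥0∞} (hg : Measurable g) :
    energy v (fun n ↦ ∫⁻ t in Ioo (0 : ℝ) 1, g t * ENNReal.ofReal t ^ n) ≤
      (8 * K + 24) * ∫⁻ ρ in Ioo (0 : ℝ) 1, vhat v ρ * derivTransform g ρ ^ 2 := by
  have hFm := measurable_derivTransform hg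
  have hvm : AEMeasurable (fun r : ℝ ↦ ENNReal.ofReal (v r)) (volume.restrict (Ioo 0 1)) :=
    hv.aemeasurable.ennreal_ofReal
  have htri := lintegral_triangle hvm (hFm.pow_const 2)
  have hzero : vhat v 0 * derivTransform g 0 ^ 2 ≤
      2 * K * ∫⁻ ρ in Ioo (0 : ℝ) 1, vhat v ρ * derivTransform g ρ ^ 2 := by
    have h1 : vhat v (1 / 2) * derivTransform g 0 ^ 2 * ENNReal.ofReal (1 / 2 - 0) ≤
        ∫⁻ ρ in Ioo (0 : ℝ) 1, vhat v ρ * derivTransform g ρ ^ 2 := by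
      refine le_trans (mul_ofReal_le_setLIntegral
        (f := fun ρ ↦ vhat v ρ * derivTransform g ρ ^ 2) fun s hs ↦ ?_)
        (lintegral_mono_set (Ioo_subset_Ioo_right (by norm_num)))
      gcongr
      · exact vhat_antitone v hs.2.le
      · exact derivTransform_zero_le g ⟨hs.1, by linarith [hs.2]⟩
    have h2 : (2 : ℝ≥0∞) * ENNReal.ofReal (1 / 2 - 0) = 1 := by
      rw [show (2 : ℝ≥0∞) = ENNReal.ofReal 2 by simp, ← ENNReal.ofReal_mul (by norm_num)]
      norm_num
    calc _ ≤ K * vhat v (1 / 2) * derivTransform g 0 ^ 2 * (2 * ENNReal.ofReal (1 / 2 - 0)) := by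
          rw [h2, mul_one]
          gcongr
          exact vhat_zero_le hK
      _ = 2 * K * (vhat v (1 / 2) * derivTransform g 0 ^ 2 * ENNReal.ofReal (1 / 2 - 0)) := by ring
      _ ≤ _ := by gcongr
  calc energy v (fun n ↦ ∫⁻ t in Ioo (0 : ℝ) 1, g t * ENNReal.ofReal t ^ n)
      ≤ 2 * ∫⁻ r in Ioo (0 : ℝ) 1, (2 * derivTransform g 0 ^ 2) * ENNReal.ofReal (v r) +
          12 * (ENNReal.ofReal (v r) * ∫⁻ ρ in Ioo 0 r, derivTransform g ρ ^ 2) := by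
        unfold energy
        gcongr 2 * ?_
        refine setLIntegral_mono' measurableSet_Ioo fun r hr ↦ ?_
        calc _ ≤ ENNReal.ofReal (v r) * 1 * (2 * derivTransform g 0 ^ 2 +
              12 * ∫⁻ ρ in Ioo 0 r, derivTransform g ρ ^ 2) := by
              gcongr
              · rw [← ENNReal.ofReal_one]
                exact ENNReal.ofReal_le_ofReal hr.2.le
              · exact tsum_sq_moment_le hg hr
          _ = _ := by ring
    _ = 4 * (vhat v 0 * derivTransform g 0 ^ 2) +
          24 * ∫⁻ ρ in Ioo (0 : ℝ) 1, derivTransform g ρ ^ 2 * vhat v ρ := by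
        rw [lintegral_add_left' (by fun_prop), lintegral_const_mul'' _ hvm,
          lintegral_const_mul' _ _ (by simp), htri]
        simp only [vhat]
        ring
    _ ≤ 4 * (2 * K * ∫⁻ ρ in Ioo (0 : ℝ) 1, vhat v ρ * derivTransform g ρ ^ 2) +
          24 * ∫⁻ ρ in Ioo (0 : ℝ) 1, vhat v ρ * derivTransform g ρ ^ 2 := by
        simp_rw [mul_comm (derivTransform g _ ^ 2)]
        gcongr
    _ = _ := by ring

/-- Hardy's inequality applied to both parts of `derivTransform g`. -/
lemma energy_le {v : ℂ → ℝ} (hv : MemDHat v) {K : ℝ≥0} (hK : DoublingWith v K)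
    (hM₁ : M₁ v < ∞) (hM₂ : M₂ v < ∞) {g : ℝ → ℝ≥0∞} (hg : Measurable g) :
    energy v (fun n ↦ ∫⁻ t in Ioo (0 : ℝ) 1, g t * ENNReal.ofReal t ^ n) ≤
      (8 * K + 24) * (8 * (M₁ v ^ 2 + M₂ v ^ 2)) * ∫⁻ t in Ioo (0 : ℝ) 1,
        g t ^ 2 * (vhat v t * ENNReal.ofReal (1 / (1 - t) ^ 2)) := by
  set P : ℝ → ℝ≥0∞ := fun ρ ↦ ∫⁻ t in Ioo 0 ρ, g t * ENNReal.ofReal (1 / (1 - t) ^ 2) with hP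
  set Q : ℝ → ℝ≥0∞ := fun ρ ↦ ENNReal.ofReal (1 / (1 - ρ) ^ 2) * ∫⁻ t in Ioo ρ 1, g t with hQ
  have hPm : Measurable P :=
    Monotone.measurable fun a b hab ↦ lintegral_mono_set (Ioo_subset_Ioo_right hab)
  have hQm : Measurable Q := by
    have : Measurable fun ρ ↦ ∫⁻ t in Ioo ρ 1, g t :=
      Antitone.measurable fun a b hab ↦ lintegral_mono_set (Ioo_subset_Ioo_left hab)
    fun_prop
  refine (energy_le_derivTransform hv.1 hK hg).trans ?_
  rw [mul_assoc]
  gcongr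
  calc ∫⁻ ρ in Ioo (0 : ℝ) 1, vhat v ρ * derivTransform g ρ ^ 2
      ≤ ∫⁻ ρ in Ioo (0 : ℝ) 1, (2 * (vhat v ρ * P ρ ^ 2) + 2 * (vhat v ρ * Q ρ ^ 2)) := by
        refine setLIntegral_mono' measurableSet_Ioo fun ρ hρ ↦ ?_
        calc _ ≤ vhat v ρ * (2 * (P ρ ^ 2 + Q ρ ^ 2)) := by
              gcongr
              exact (pow_le_pow_left' (derivTransform_le hg hρ) 2).trans (add_sq_le_two_mul _ _)
          _ = _ := by ring
    _ = 2 * (∫⁻ ρ in Ioo (0 : ℝ) 1, vhat v ρ * P ρ ^ 2) +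
          2 * ∫⁻ ρ in Ioo (0 : ℝ) 1, vhat v ρ * Q ρ ^ 2 := by
        rw [lintegral_add_left (by fun_prop), lintegral_const_mul _ (by fun_prop),
          lintegral_const_mul _ (by fun_prop)]
    _ ≤ _ := by
        grw [lintegral_vhat_mul_sq_left_le hv hM₁ hg, lintegral_vhat_mul_sq_right_le hv hM₂ hg]
        exact le_of_eq (by ring)

/-- Half of the dual mass is controlled by `M₂` at `r = 1 / 2`, the other half by monotonicity. -/
lemma dualTail_zero_le {v : ℂ → ℝ} (hv : MemDHat v) {K m : ℝ≥0} (hm : 0 < m)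
    (hK : DoublingWith v K) (hmv : m ≤ vhat v 0) :
    dualTail v 0 ≤ 130 * (K / m : ℝ≥0) * M₂ v ^ 2 := by
  have h0 := vhat_ne_zero hv.1 (show (0 : ℝ) ≤ 1 / 2 by norm_num) (by norm_num)
  have ht := vhat_ne_top hv (show (0 : ℝ) ≤ 1 / 2 by norm_num)
  have hinv : (vhat v (1 / 2))⁻¹ ≤ (K / m : ℝ≥0) := by
    have h1 : (m : ℝ≥0∞) ≤ K * vhat v (1 / 2) := hmv.trans (vhat_zero_le hK)
    rw [ENNReal.coe_div hm.ne', ENNReal.le_div_iff_mul_le (Or.inl (by simpa using hm.ne'))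
      (Or.inl (by simp))]
    calc _ ≤ (vhat v (1 / 2))⁻¹ * (K * vhat v (1 / 2)) := by gcongr
      _ = K * ((vhat v (1 / 2))⁻¹ * vhat v (1 / 2)) := by ring
      _ = K := by rw [ENNReal.inv_mul_cancel h0 ht, mul_one]
  have h1 : ∫⁻ s in Ioo (0 : ℝ) (1 / 2), ENNReal.ofReal ((1 - s) ^ 2) * (vhat v s)⁻¹ ≤
      (K / m : ℝ≥0) * (128 * M₂ v ^ 2) := by
    calc _ ≤ ∫⁻ s in Ioo (0 : ℝ) (1 / 2), (K / m : ℝ≥0) := by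
          refine setLIntegral_mono' measurableSet_Ioo fun s hs ↦ ?_
          calc _ ≤ 1 * (vhat v (1 / 2))⁻¹ := by
                gcongr
                · rw [← ENNReal.ofReal_one]
                  exact ENNReal.ofReal_le_ofReal (by nlinarith [hs.1, hs.2])
                · exact vhat_antitone v hs.2.le
            _ ≤ _ := by rwa [one_mul]
      _ ≤ (K / m : ℝ≥0) * 1 := by
          rw [setLIntegral_const, Real.volume_Ioo]
          gcongr
          rw [← ENNReal.ofReal_one]
          exact ENNReal.ofReal_le_ofReal (by norm_num)
      _ ≤ _ := by gcongr; exact one_le_sq_M₂ hv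
  have h2 : dualTail v (1 / 2) ≤ (K / m : ℝ≥0) * (2 * M₂ v ^ 2) := by
    have h3 := (mul_le_mul' (vhat_half_mul_le v) le_rfl).trans
      (mul_le_sq_M₂ v (r := 1 / 2) ⟨by norm_num, by norm_num⟩)
    have h4 : (2 : ℝ≥0∞) * ENNReal.ofReal (1 / 2 - 0) = 1 := by
      rw [show (2 : ℝ≥0∞) = ENNReal.ofReal 2 by simp, ← ENNReal.ofReal_mul (by norm_num)]
      norm_num
    calc dualTail v (1 / 2) = ((vhat v (1 / 2))⁻¹ * vhat v (1 / 2)) *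
          (2 * ENNReal.ofReal (1 / 2 - 0)) * dualTail v (1 / 2) := by
          rw [ENNReal.inv_mul_cancel h0 ht, h4]; simp
      _ = (vhat v (1 / 2))⁻¹ * (2 * (vhat v (1 / 2) * ENNReal.ofReal (1 / 2 - 0) *
          dualTail v (1 / 2))) := by ring
      _ ≤ _ := by gcongr
  calc dualTail v 0 = (∫⁻ s in Ioo (0 : ℝ) (1 / 2),
        ENNReal.ofReal ((1 - s) ^ 2) * (vhat v s)⁻¹) + dualTail v (1 / 2) := by
        rw [dualTail, ← Ioc_union_Ioo_eq_Ioo (show (0 : ℝ) ≤ 1 / 2 by norm_num) (by norm_num),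
          lintegral_union measurableSet_Ioo (by
            rw [Set.disjoint_left]; exact fun x hx hx' ↦ not_lt.2 hx.2 hx'.1),
          setLIntegral_congr Ioo_ae_eq_Ioc.symm, dualTail]
    _ ≤ _ := add_le_add h1 h2
    _ = _ := by ring

/-- Boundedness of the sublinear Hilbert operator, with a bound of the order `M₁ M₂`. -/
lemma dirichletNorm_sublinearHilbertOp_le (K m : ℝ≥0) (hm : 0 < m) :
    ∃ C : ℝ≥0, 0 < C ∧ ∀ v : ℂ → ℝ, MemDHat v → IntegrabilityCondition v → M₁ v < ∞ → M₂ v < ∞ →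
      DoublingWith v K → m ≤ vhat v 0 → ∀ φ : ℝ → ℂ, MemLp φ 2 (measV2 v) →
        dirichletNorm v (sublinearHilbertOp φ) ≤ C * (M₁ v * M₂ v) * eLpNorm φ 2 (measV2 v) := by
  set D : ℝ≥0 := (8 * K + 24) * 2048 + 16640 * (K / m) with hD
  refine ⟨D + 1, by positivity, fun v hv hI hM₁ hM₂ hK hmv φ hφ ↦ ?_⟩
  have hφm := aemeasurable_of_measV2 hv.1 hφ.1
  have hint := integrableOn_of_memLp hv hI hφ
  obtain ⟨g, hg, hgφ⟩ := hφm.enorm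
  have e1 : absMoment φ = fun n ↦ ∫⁻ t in Ioo (0 : ℝ) 1, g t * ENNReal.ofReal t ^ n := by
    ext n
    refine lintegral_congr_ae ?_
    filter_upwards [hgφ] with t ht
    rw [ht]
  have e2 : symbolEnergy v φ = ∫⁻ t in Ioo (0 : ℝ) 1,
      g t ^ 2 * (vhat v t * ENNReal.ofReal (1 / (1 - t) ^ 2)) := by
    refine lintegral_congr_ae ?_
    filter_upwards [hgφ] with t ht
    rw [ht]
  have h1 := energy_le hv hK hM₁ hM₂ hg
  rw [← e1, ← e2] at h1
  have h2 := (sq_absMoment_zero_le hv hφm).trans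
    (mul_le_mul' le_rfl (dualTail_zero_le hv hm hK hmv))
  have b1 : M₁ v ^ 2 ≤ 128 * (M₁ v * M₂ v) ^ 2 := by
    calc M₁ v ^ 2 = M₁ v ^ 2 * 1 := (mul_one _).symm
      _ ≤ M₁ v ^ 2 * (128 * M₂ v ^ 2) := by gcongr; exact one_le_sq_M₂ hv
      _ = _ := by ring
  have b2 : M₂ v ^ 2 ≤ 128 * (M₁ v * M₂ v) ^ 2 := by
    calc M₂ v ^ 2 = M₂ v ^ 2 * 1 := (mul_one _).symm
      _ ≤ M₂ v ^ 2 * (128 * M₁ v ^ 2) := by gcongr; exact one_le_sq_M₁ hv hI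
      _ = _ := by ring
  have h3 : absMoment φ 0 ^ 2 + energy v (absMoment φ) ≤
      ((D + 1 : ℝ≥0) * (M₁ v * M₂ v)) ^ 2 * symbolEnergy v φ := by
    have hDD : (D : ℝ≥0∞) ≤ ((D + 1 : ℝ≥0) : ℝ≥0∞) ^ 2 := by
      have : D ≤ (D + 1) ^ 2 := by nlinarith [D.2, sq_nonneg (D : ℝ)]
      exact_mod_cast this
    calc _ ≤ symbolEnergy v φ * (130 * (K / m : ℝ≥0) * (128 * (M₁ v * M₂ v) ^ 2)) +
          (8 * K + 24) * (8 * (128 * (M₁ v * M₂ v) ^ 2 + 128 * (M₁ v * M₂ v) ^ 2)) *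
            symbolEnergy v φ := by
          refine add_le_add (h2.trans ?_) (h1.trans ?_)
          · gcongr
          · gcongr
      _ = D * (M₁ v * M₂ v) ^ 2 * symbolEnergy v φ := by
          rw [hD]; push_cast; ring
      _ ≤ ((D + 1 : ℝ≥0) : ℝ≥0∞) ^ 2 * (M₁ v * M₂ v) ^ 2 * symbolEnergy v φ := by gcongr
      _ = _ := by ring
  rw [dirichletNorm_sublinearHilbertOp hv.1 hint, eLpNorm_eq hφm]
  calc _ ≤ (((D + 1 : ℝ≥0) * (M₁ v * M₂ v)) ^ 2 * symbolEnergy v φ) ^ (1 / 2 : ℝ) := by gcongr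
    _ = _ := by
      rw [ENNReal.mul_rpow_of_nonneg _ _ (by norm_num), ← ENNReal.rpow_natCast,
        ← ENNReal.rpow_mul]
      norm_num

/-! ### The lower bound -/

/-- The derivative of `x (1 - c x²)⁻³` is `(1 + 5 c x²) (1 - c x²)⁻⁴`. -/
lemma lintegral_one_div_pow_four_le {c ρ : ℝ} (hc : c ∈ Ioo (0 : ℝ) 1) (hρ : ρ ∈ Ioo (0 : ℝ) 1) :
    ∫⁻ x in Ioo 0 ρ, ENNReal.ofReal (1 / (1 - c * x ^ 2) ^ 4) ≤
      ENNReal.ofReal (ρ / (1 - c * ρ ^ 2) ^ 3) := by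
  have hpos : ∀ x ∈ Icc (0 : ℝ) ρ, 0 < 1 - c * x ^ 2 := by
    intro x hx
    have h1 : x ^ 2 < 1 := by nlinarith [hx.1, hx.2, hρ.2]
    nlinarith [hc.1, hc.2]
  have hcont : ContinuousOn (fun x : ℝ ↦ (1 + 5 * c * x ^ 2) / (1 - c * x ^ 2) ^ 4) (Icc 0 ρ) :=
    ContinuousOn.div (by fun_prop) (by fun_prop) fun x hx ↦ (pow_pos (hpos x hx) 4).ne'
  have hFTC : ∫ x in (0 : ℝ)..ρ, (1 + 5 * c * x ^ 2) / (1 - c * x ^ 2) ^ 4 =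
      ρ / (1 - c * ρ ^ 2) ^ 3 - 0 / (1 - c * 0 ^ 2) ^ 3 := by
    refine intervalIntegral.integral_eq_sub_of_hasDerivAt
      (f := fun x ↦ x / (1 - c * x ^ 2) ^ 3) (fun x hx ↦ ?_) ?_
    · rw [uIcc_of_le hρ.1.le] at hx
      have h0 := hpos x hx
      have h1 : HasDerivAt (fun x : ℝ ↦ (1 - c * x ^ 2) ^ 3)
          (3 * (1 - c * x ^ 2) ^ 2 * (-(c * (2 * x)))) x := by
        have := ((((hasDerivAt_id x).fun_pow 2).const_mul c).const_sub 1).fun_pow 3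
        simpa using this
      have h2 := (hasDerivAt_id' x).fun_div h1 (pow_pos h0 3).ne'
      refine h2.congr_deriv ?_
      field_simp
      ring
    · apply ContinuousOn.intervalIntegrable
      rwa [uIcc_of_le hρ.1.le]
  have hnn : ∀ x ∈ Ioo 0 ρ, 0 ≤ (1 + 5 * c * x ^ 2) / (1 - c * x ^ 2) ^ 4 := fun x hx ↦ by
    have := hpos x (Ioo_subset_Icc_self hx)
    have := hc.1
    positivity
  calc ∫⁻ x in Ioo 0 ρ, ENNReal.ofReal (1 / (1 - c * x ^ 2) ^ 4)
      ≤ ∫⁻ x in Ioo 0 ρ, ENNReal.ofReal ((1 + 5 * c * x ^ 2) / (1 - c * x ^ 2) ^ 4) := by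
        refine setLIntegral_mono' measurableSet_Ioo fun x hx ↦ ENNReal.ofReal_le_ofReal ?_
        have := hpos x (Ioo_subset_Icc_self hx)
        have := hc.1
        gcongr
        nlinarith [sq_nonneg x]
    _ = ENNReal.ofReal (∫ x in Ioo 0 ρ, (1 + 5 * c * x ^ 2) / (1 - c * x ^ 2) ^ 4) :=
        (ofReal_integral_eq_lintegral_ofReal
          (hcont.integrableOn_Icc.mono_set Ioo_subset_Icc_self)
          (by
            filter_upwards [self_mem_ae_restrict measurableSet_Ioo] with x hx using hnn x hx)).symm
    _ = _ := by
        rw [← integral_Ioc_eq_integral_Ioo, ← intervalIntegral.integral_of_le hρ.1.le, hFTC]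
        simp

/-- The symbol used to test boundedness: the dual weight `(1 - s)² / v̂(s)` cut off to `(r, 1)`. -/
def testSymbol (v : ℂ → ℝ) (r : ℝ) (s : ℝ) : ℂ :=
  ((Ioo r 1).indicator (fun s ↦ (ENNReal.ofReal ((1 - s) ^ 2) * (vhat v s)⁻¹).toReal) s : ℝ)

lemma measurable_testSymbol (v : ℂ → ℝ) (r : ℝ) : Measurable (testSymbol v r) := by
  unfold testSymbol
  refine Complex.measurable_ofReal.comp (Measurable.indicator ?_ measurableSet_Ioo)
  fun_prop

lemma norm_testSymbol (v : ℂ → ℝ) (r s : ℝ) : (‖testSymbol v r s‖ : ℂ) = testSymbol v r s := by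
  rw [testSymbol, Complex.norm_real, Real.norm_of_nonneg]
  exact indicator_nonneg (fun _ _ ↦ ENNReal.toReal_nonneg) s

lemma enorm_testSymbol {v : ℂ → ℝ} (hv : MemDHat v) {r : ℝ} (hr : 0 < r) (s : ℝ) :
    ‖testSymbol v r s‖ₑ =
      (Ioo r 1).indicator (fun s ↦ ENNReal.ofReal ((1 - s) ^ 2) * (vhat v s)⁻¹) s := by
  by_cases hs : s ∈ Ioo r 1
  · rw [testSymbol, indicator_of_mem hs, indicator_of_mem hs, ← ofReal_norm, Complex.norm_real,
      Real.norm_of_nonneg ENNReal.toReal_nonneg, ENNReal.ofReal_toReal]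
    exact ENNReal.mul_ne_top (by finiteness)
      (ENNReal.inv_ne_top.2 (vhat_ne_zero hv.1 (hr.trans hs.1).le hs.2))
  · rw [testSymbol, indicator_of_notMem hs, indicator_of_notMem hs]
    simp

lemma symbolEnergy_testSymbol {v : ℂ → ℝ} (hv : MemDHat v) {r : ℝ} (hr : r ∈ Ioo (0 : ℝ) 1) :
    symbolEnergy v (testSymbol v r) = dualTail v r := by
  have e : ∀ s ∈ Ioo (0 : ℝ) 1, ‖testSymbol v r s‖ₑ ^ 2 *
      (vhat v s * ENNReal.ofReal (1 / (1 - s) ^ 2)) =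
      (Ioi r).indicator (fun s ↦ ENNReal.ofReal ((1 - s) ^ 2) * (vhat v s)⁻¹) s := by
    intro s hs
    rw [enorm_testSymbol hv hr.1]
    by_cases h : r < s
    · rw [indicator_of_mem (show s ∈ Ioo r 1 from ⟨h, hs.2⟩), indicator_of_mem (by exact h),
        sq, mul_assoc, ← inv_weight_eq hv hs.1.le hs.2, ENNReal.inv_mul_cancel, mul_one]
      · exact mul_ne_zero (vhat_ne_zero hv.1 hs.1.le hs.2)
          (ofReal_one_div_one_sub_pow_ne_zero hs.2 2)
      · exact ENNReal.mul_ne_top (vhat_ne_top hv hs.1.le) (by finiteness)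
    · rw [indicator_of_notMem (fun h' ↦ h h'.1), indicator_of_notMem (by exact h)]
      simp
  rw [symbolEnergy, setLIntegral_congr_fun measurableSet_Ioo e,
    lintegral_indicator measurableSet_Ioi, restrict_Ioo_restrict_Ioi hr, dualTail]

lemma le_absMoment_testSymbol {v : ℂ → ℝ} (hv : MemDHat v) {r : ℝ} (hr : r ∈ Ioo (0 : ℝ) 1)
    (n : ℕ) : ENNReal.ofReal r ^ n * dualTail v r ≤ absMoment (testSymbol v r) n := by
  rw [dualTail, ← lintegral_const_mul _ (by fun_prop), absMoment]
  refine le_trans (setLIntegral_mono' measurableSet_Ioo fun s hs ↦ ?_)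
    (lintegral_mono_set (Ioo_subset_Ioo_left hr.1.le))
  rw [enorm_testSymbol hv hr.1, indicator_of_mem hs, mul_comm]
  gcongr
  exact hs.1.le

/-- Coefficients of size at least `rⁿ I` have energy at least the stated integral; the left-over
`ρ (1 - r² ρ²)⁻³` is integrated by parts, through `lintegral_one_div_pow_four_le`. -/
lemma energy_lower {v : ℂ → ℝ} (hv : IsRadialWeight v) {r : ℝ} (hr : r ∈ Ioo (0 : ℝ) 1)
    {b : ℕ → ℝ≥0∞} {I : ℝ≥0∞} (hb : ∀ n, ENNReal.ofReal r ^ n * I ≤ b n) :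
    2 * ENNReal.ofReal r ^ 2 * I ^ 2 * ∫⁻ x in Ioo (0 : ℝ) 1, vhat v x *
      ENNReal.ofReal (1 / (1 - r ^ 2 * x ^ 2) ^ 4) ≤ energy v b := by
  have hvm : AEMeasurable (fun r : ℝ ↦ ENNReal.ofReal (v r)) (volume.restrict (Ioo 0 1)) :=
    hv.aemeasurable.ennreal_ofReal
  have htri := lintegral_triangle hvm
    (h := fun x ↦ ENNReal.ofReal (1 / (1 - r ^ 2 * x ^ 2) ^ 4)) (by fun_prop)
  have hc : r ^ 2 ∈ Ioo (0 : ℝ) 1 := ⟨by have := hr.1; positivity, by nlinarith [hr.1, hr.2]⟩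
  have e1 : ∫⁻ x in Ioo (0 : ℝ) 1, vhat v x * ENNReal.ofReal (1 / (1 - r ^ 2 * x ^ 2) ^ 4) =
      ∫⁻ ρ in Ioo (0 : ℝ) 1, ENNReal.ofReal (v ρ) *
        ∫⁻ x in Ioo 0 ρ, ENNReal.ofReal (1 / (1 - r ^ 2 * x ^ 2) ^ 4) := by
    rw [htri]
    simp_rw [mul_comm (vhat v _)]
    rfl
  have hmono : Measurable fun ρ ↦ ∫⁻ x in Ioo 0 ρ, ENNReal.ofReal (1 / (1 - r ^ 2 * x ^ 2) ^ 4) :=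
    Monotone.measurable fun a b hab ↦ lintegral_mono_set (Ioo_subset_Ioo_right hab)
  have hprod : AEMeasurable (fun ρ : ℝ ↦ ENNReal.ofReal (v ρ) *
      ∫⁻ x in Ioo 0 ρ, ENNReal.ofReal (1 / (1 - r ^ 2 * x ^ 2) ^ 4))
      (volume.restrict (Ioo 0 1)) := hvm.mul hmono.aemeasurable
  rw [e1, energy, mul_assoc 2, mul_assoc 2, ← lintegral_const_mul'' _ hprod]
  gcongr 2 * ?_
  refine setLIntegral_mono' measurableSet_Ioo fun ρ hρ ↦ ?_
  have hx : r ^ 2 * ρ ^ 2 ∈ Ico (0 : ℝ) 1 := by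
    refine ⟨by positivity, ?_⟩
    have : ρ ^ 2 < 1 := by nlinarith [hρ.1, hρ.2]
    nlinarith [hc.1, hc.2]
  calc ENNReal.ofReal r ^ 2 * I ^ 2 * (ENNReal.ofReal (v ρ) *
        ∫⁻ x in Ioo 0 ρ, ENNReal.ofReal (1 / (1 - r ^ 2 * x ^ 2) ^ 4))
      ≤ ENNReal.ofReal r ^ 2 * I ^ 2 * (ENNReal.ofReal (v ρ) *
        (ENNReal.ofReal ρ * ENNReal.ofReal (1 / (1 - r ^ 2 * ρ ^ 2) ^ 3))) := by
        gcongr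
        refine (lintegral_one_div_pow_four_le hc hρ).trans_eq ?_
        rw [← ENNReal.ofReal_mul hρ.1.le]
        congr 1
        ring
    _ ≤ ENNReal.ofReal r ^ 2 * I ^ 2 * (ENNReal.ofReal (v ρ) *
        (ENNReal.ofReal ρ * ∑' n : ℕ, ((n : ℝ≥0∞) + 1) ^ 2 *
          ENNReal.ofReal (r ^ 2 * ρ ^ 2) ^ n)) := by
        gcongr
        exact le_tsum_sq_succ_mul_pow hx.1 hx.2
    _ = ENNReal.ofReal (v ρ) * ENNReal.ofReal ρ * ∑' n : ℕ, (ENNReal.ofReal r ^ 2 * I ^ 2) *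
          (((n : ℝ≥0∞) + 1) ^ 2 * ENNReal.ofReal (r ^ 2 * ρ ^ 2) ^ n) := by
        rw [ENNReal.tsum_mul_left]; ring
    _ ≤ _ := by
        refine mul_le_mul_right (ENNReal.tsum_le_tsum fun n ↦ ?_) _
        calc _ = ((n : ℝ≥0∞) + 1) ^ 2 * (ENNReal.ofReal r ^ (n + 1) * I) ^ 2 *
              ENNReal.ofReal ρ ^ (2 * n) := by
              rw [ENNReal.ofReal_mul (sq_nonneg r), ENNReal.ofReal_pow hr.1.le,
                ENNReal.ofReal_pow hρ.1.le]
              ring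
          _ ≤ _ := by gcongr; exact hb _

lemma dualTail_ne_zero {v : ℂ → ℝ} (hv : MemDHat v) {r : ℝ} (hr : r ∈ Ioo (0 : ℝ) 1) :
    dualTail v r ≠ 0 := by
  refine setLIntegral_Ioo_ne_zero hr.2 (by fun_prop) fun s hs ↦ mul_ne_zero ?_ ?_
  · have : 0 < 1 - s := by linarith [hs.2]
    simp only [ne_eq, ENNReal.ofReal_eq_zero, not_le]
    positivity
  · exact ENNReal.inv_ne_zero.2 (vhat_ne_top hv (hr.1.trans hs.1).le)

/-- The estimate that testing on `testSymbol v r` provides. -/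
lemma le_sq_of_boundedWith {v : ℂ → ℝ} (hv : MemDHat v) (hI : IntegrabilityCondition v)
    {C : ℝ≥0} (hC : BoundedWith v hilbertOp C) {r : ℝ} (hr : r ∈ Ioo (0 : ℝ) 1) :
    2 * ENNReal.ofReal r ^ 2 * dualTail v r * ∫⁻ x in Ioo (0 : ℝ) 1, vhat v x *
      ENNReal.ofReal (1 / (1 - r ^ 2 * x ^ 2) ^ 4) ≤ C ^ 2 := by
  have hm := (measurable_testSymbol v r).aemeasurable (μ := volume.restrict (Ioo (0 : ℝ) 1))
  have hnorm := eLpNorm_eq (v := v) hm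
  rw [symbolEnergy_testSymbol hv hr] at hnorm
  have hIt := hI.dualTail_ne_top hr.1.le
  have hφ : MemLp (testSymbol v r) 2 (measV2 v) := by
    refine ⟨(measurable_testSymbol v r).aestronglyMeasurable, ?_⟩
    rw [hnorm]
    exact ENNReal.rpow_lt_top_of_nonneg (by norm_num) hIt
  have hint := integrableOn_of_memLp hv hI hφ
  have h1 := (hC _ hφ).2
  have hself : (fun t ↦ (‖testSymbol v r t‖ : ℂ)) = testSymbol v r :=
    funext (norm_testSymbol v r)
  have hb : ∀ n, ENNReal.ofReal r ^ n * dualTail v r ≤ ‖moment (testSymbol v r) n‖ₑ := by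
    intro n
    rw [← hself, enorm_moment_norm hint]
    exact le_absMoment_testSymbol hv hr n
  rw [hnorm, dirichletNorm_hilbertOp hv.1 hint] at h1
  have h2 := pow_le_pow_left' h1 2
  rw [sq_rpow_half, mul_pow, sq_rpow_half] at h2
  have h3 := (energy_lower hv.1 hr hb).trans (le_add_self.trans h2)
  rw [← ENNReal.mul_le_mul_iff_left (dualTail_ne_zero hv hr) hIt]
  refine le_trans (le_of_eq ?_) h3
  ring

/-- Boundedness of the Hilbert operator bounds `M₂`. For `r ≥ 1 / 2` the test symbol suffices; for
smaller `r` the part of the dual weight on `(r, 1 / 2)` is handled by `M₁` and duality at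
`1 / 2`. -/
lemma M₂_le_of_boundedWith {v : ℂ → ℝ} (hv : MemDHat v) (hI : IntegrabilityCondition v)
    {C : ℝ≥0} (hC : BoundedWith v hilbertOp C) : M₂ v ≤ 257 * C * M₁ v := by
  have hM₁ := one_le_sq_M₁ hv hI
  have hlarge : ∀ r ∈ Ico (1 / 2 : ℝ) 1,
      (∫⁻ s in Ioo 0 r, vhat v s * ENNReal.ofReal (1 / (1 - s) ^ 4)) * dualTail v r ≤
        512 * C ^ 2 := by
    intro r hr
    have hr' : r ∈ Ioo (0 : ℝ) 1 := ⟨by linarith [hr.1], hr.2⟩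
    have h1 : ∫⁻ s in Ioo 0 r, vhat v s * ENNReal.ofReal (1 / (1 - s) ^ 4) ≤
        256 * ∫⁻ x in Ioo (0 : ℝ) 1, vhat v x *
          ENNReal.ofReal (1 / (1 - r ^ 2 * x ^ 2) ^ 4) := by
      rw [← lintegral_const_mul _ (by fun_prop)]
      refine le_trans (setLIntegral_mono' measurableSet_Ioo fun x hx ↦ ?_)
        (lintegral_mono_set (Ioo_subset_Ioo_right hr.2.le))
      have hx1 : 0 < 1 - x := by linarith [hx.2, hr.2]
      -- `1 - r² x² ≤ 1 - x⁴ ≤ 4 (1 - x)` for `x < r`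
      have hrx : x ^ 2 ≤ r ^ 2 := pow_le_pow_left₀ hx.1.le hx.2.le 2
      have hx4 : x ^ 2 * x ^ 2 ≤ r ^ 2 * x ^ 2 := by gcongr
      have h4 : 1 - r ^ 2 * x ^ 2 ≤ 4 * (1 - x) := by
        nlinarith [sq_nonneg (x ^ 2 - 1), sq_nonneg (x - 1)]
      have h0 : 0 < 1 - r ^ 2 * x ^ 2 := by
        have : r ^ 2 < 1 := by nlinarith [hr'.1, hr'.2]
        have : x ^ 2 < 1 := lt_of_le_of_lt hrx this
        nlinarith [sq_nonneg x, sq_nonneg r]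
      calc _ ≤ vhat v x * ENNReal.ofReal (256 * (1 / (1 - r ^ 2 * x ^ 2) ^ 4)) := by
            gcongr
            calc 1 / (1 - x) ^ 4 = 256 * (1 / (4 * (1 - x)) ^ 4) := by field_simp; norm_num
              _ ≤ _ := by gcongr
        _ = _ := by
            rw [ENNReal.ofReal_mul (by norm_num), ENNReal.ofReal_ofNat]; ring
    have h2 : (1 : ℝ≥0∞) ≤ 4 * ENNReal.ofReal r ^ 2 := by
      rw [show (4 : ℝ≥0∞) = ENNReal.ofReal 4 by simp, ← ENNReal.ofReal_pow hr'.1.le,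
        ← ENNReal.ofReal_mul (by norm_num), ← ENNReal.ofReal_one]
      exact ENNReal.ofReal_le_ofReal (by nlinarith [hr.1])
    calc _ ≤ (256 * ∫⁻ x in Ioo (0 : ℝ) 1, vhat v x *
          ENNReal.ofReal (1 / (1 - r ^ 2 * x ^ 2) ^ 4)) * dualTail v r *
          (4 * ENNReal.ofReal r ^ 2) := by
          refine (mul_le_mul_left h1 _).trans ?_
          exact le_mul_of_one_le_right' h2
      _ = 512 * (2 * ENNReal.ofReal r ^ 2 * dualTail v r * ∫⁻ x in Ioo (0 : ℝ) 1, vhat v x *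
          ENNReal.ofReal (1 / (1 - r ^ 2 * x ^ 2) ^ 4)) := by ring
      _ ≤ _ := by
          gcongr
          exact le_sq_of_boundedWith hv hI hC hr'
  have hhalf : (1 / 2 : ℝ) ∈ Ioo (0 : ℝ) 1 := ⟨by norm_num, by norm_num⟩
  -- the test at `r = 1 / 2` also controls the total mass of the tail
  have hW : (∫⁻ s in Ioo (0 : ℝ) 1, vhat v s) * dualTail v (1 / 2) ≤ 2 * C ^ 2 := by
    have h1 : ∫⁻ s in Ioo (0 : ℝ) 1, vhat v s ≤ ∫⁻ x in Ioo (0 : ℝ) 1, vhat v x *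
          ENNReal.ofReal (1 / (1 - (1 / 2) ^ 2 * x ^ 2) ^ 4) := by
      refine setLIntegral_mono' measurableSet_Ioo fun x hx ↦ ?_
      refine le_mul_of_one_le_right' ?_
      have h2 : x ^ 2 < 1 := by nlinarith [hx.1, hx.2]
      have h3 : 0 < 1 - (1 / 2) ^ 2 * x ^ 2 := by nlinarith
      rw [← ENNReal.ofReal_one]
      apply ENNReal.ofReal_le_ofReal
      rw [le_div_iff₀ (by positivity), one_mul]
      exact pow_le_one₀ h3.le (by nlinarith [sq_nonneg x])
    have h2 : (2 : ℝ≥0∞) * (2 * ENNReal.ofReal (1 / 2) ^ 2) = 1 := by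
      rw [show (2 : ℝ≥0∞) = ENNReal.ofReal 2 by simp, ← ENNReal.ofReal_pow (by norm_num),
        ← ENNReal.ofReal_mul (by norm_num), ← ENNReal.ofReal_mul (by norm_num)]
      norm_num
    calc _ ≤ (∫⁻ x in Ioo (0 : ℝ) 1, vhat v x *
          ENNReal.ofReal (1 / (1 - (1 / 2) ^ 2 * x ^ 2) ^ 4)) * dualTail v (1 / 2) *
          (2 * (2 * ENNReal.ofReal (1 / 2) ^ 2)) := by
          rw [h2, mul_one]; gcongr
      _ = 2 * (2 * ENNReal.ofReal (1 / 2) ^ 2 * dualTail v (1 / 2) * ∫⁻ x in Ioo (0 : ℝ) 1,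
          vhat v x * ENNReal.ofReal (1 / (1 - (1 / 2) ^ 2 * x ^ 2) ^ 4)) := by ring
      _ ≤ _ := by
          gcongr
          exact le_sq_of_boundedWith hv hI hC hhalf
  -- duality on `(1 / 2, 1)`
  have hJ : 1 ≤ 4 * ((∫⁻ s in Ioo (1 / 2 : ℝ) 1, vhat v s * ENNReal.ofReal (1 / (1 - s) ^ 2)) *
      dualTail v (1 / 2)) := by
    have h1 := sq_lintegral_le_weighted (volume.restrict (Ioo (1 / 2 : ℝ) 1)) (g := fun _ ↦ 1)
      (s := fun s ↦ vhat v s * ENNReal.ofReal (1 / (1 - s) ^ 2)) (by fun_prop) (by fun_prop) (by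
        filter_upwards [self_mem_ae_restrict measurableSet_Ioo] with s hs
        have hs0 : 0 ≤ s := by linarith [hs.1]
        exact ⟨mul_ne_zero (vhat_ne_zero hv.1 hs0 hs.2)
            (ofReal_one_div_one_sub_pow_ne_zero hs.2 2),
          ENNReal.mul_ne_top (vhat_ne_top hv hs0) (by finiteness)⟩)
    rw [setLIntegral_congr_fun measurableSet_Ioo
      fun s hs ↦ inv_weight_eq hv (by linarith [hs.1]) hs.2] at h1
    simp only [lintegral_const, one_pow, one_mul, Measure.restrict_apply_univ,
      Real.volume_Ioo] at h1
    calc (1 : ℝ≥0∞) = 4 * ENNReal.ofReal (1 - 1 / 2) ^ 2 := by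
          rw [show (4 : ℝ≥0∞) = ENNReal.ofReal 4 by simp, ← ENNReal.ofReal_pow (by norm_num),
            ← ENNReal.ofReal_mul (by norm_num)]
          norm_num
      _ ≤ _ := by gcongr; exact h1
  refine M₂_le fun r hr ↦ ?_
  have hfin : 512 * (C : ℝ≥0∞) ^ 2 + 128 * (C ^ 2 * M₁ v ^ 2) ≤ (257 * C * M₁ v) ^ 2 := by
    calc _ ≤ 512 * (C : ℝ≥0∞) ^ 2 * (128 * M₁ v ^ 2) + 128 * (C ^ 2 * M₁ v ^ 2) := by
          gcongr ?_ + _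
          exact le_mul_of_one_le_right' hM₁
      _ = 65664 * (C ^ 2 * M₁ v ^ 2) := by ring
      _ ≤ 66049 * (C ^ 2 * M₁ v ^ 2) := by gcongr; norm_num
      _ = _ := by ring
  refine le_trans ?_ hfin
  rcases le_or_gt (1 / 2) r with hr2 | hr2
  · exact (hlarge r ⟨hr2, hr.2⟩).trans le_self_add
  · set A := ∫⁻ s in Ioo 0 r, vhat v s * ENNReal.ofReal (1 / (1 - s) ^ 4) with hA
    have hsplit : dualTail v r = (∫⁻ s in Ioo r (1 / 2),
        ENNReal.ofReal ((1 - s) ^ 2) * (vhat v s)⁻¹) + dualTail v (1 / 2) := by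
      rw [dualTail, ← Ioc_union_Ioo_eq_Ioo hr2.le (by norm_num),
        lintegral_union measurableSet_Ioo (by
          rw [Set.disjoint_left]; exact fun x hx hx' ↦ not_lt.2 hx.2 hx'.1),
        setLIntegral_congr Ioo_ae_eq_Ioc.symm, dualTail]
    have h1 : A * dualTail v (1 / 2) ≤ 512 * C ^ 2 := by
      refine le_trans ?_ (hlarge (1 / 2) ⟨le_rfl, by norm_num⟩)
      gcongr
      exact lintegral_mono_set (Ioo_subset_Ioo_right hr2.le)
    have hA2 : A ≤ 16 * ∫⁻ s in Ioo (0 : ℝ) 1, vhat v s := by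
      rw [← lintegral_const_mul _ (by fun_prop)]
      refine le_trans (setLIntegral_mono' measurableSet_Ioo fun x hx ↦ ?_)
        (lintegral_mono_set (Ioo_subset_Ioo_right hr.2.le))
      rw [mul_comm]
      gcongr
      rw [show (16 : ℝ≥0∞) = ENNReal.ofReal 16 by simp]
      apply ENNReal.ofReal_le_ofReal
      have h2 : 1 / 2 ≤ 1 - x := by linarith [hx.2]
      calc 1 / (1 - x) ^ 4 ≤ 1 / (1 / 2) ^ 4 := by gcongr
        _ = 16 := by norm_num
    have hN : ∫⁻ s in Ioo r (1 / 2), ENNReal.ofReal ((1 - s) ^ 2) * (vhat v s)⁻¹ ≤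
        ∫⁻ s in Ioo (0 : ℝ) (1 / 2), (vhat v s)⁻¹ := by
      refine le_trans (setLIntegral_mono' measurableSet_Ioo fun x hx ↦ ?_)
        (lintegral_mono_set (Ioo_subset_Ioo_left hr.1.le))
      refine mul_le_of_le_one_left' ?_
      rw [← ENNReal.ofReal_one]
      exact ENNReal.ofReal_le_ofReal (by nlinarith [hx.1, hx.2, hr.1])
    have h2 : A * (∫⁻ s in Ioo r (1 / 2), ENNReal.ofReal ((1 - s) ^ 2) * (vhat v s)⁻¹) ≤
        128 * (C ^ 2 * M₁ v ^ 2) := by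
      set J := ∫⁻ s in Ioo (1 / 2 : ℝ) 1, vhat v s * ENNReal.ofReal (1 / (1 - s) ^ 2) with hJd
      set W := ∫⁻ s in Ioo (0 : ℝ) 1, vhat v s with hWd
      set N := ∫⁻ s in Ioo (0 : ℝ) (1 / 2), (vhat v s)⁻¹ with hNd
      calc _ ≤ (16 * W) * N := mul_le_mul' hA2 hN
        _ ≤ (16 * W) * N * (4 * (J * dualTail v (1 / 2))) := le_mul_of_one_le_right' hJ
        _ = 64 * ((W * dualTail v (1 / 2)) * (J * N)) := by ring
        _ ≤ 64 * ((2 * C ^ 2) * M₁ v ^ 2) := by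
            gcongr
            exact mul_le_sq_M₁ v hhalf
        _ = _ := by ring
    rw [hsplit, mul_add, add_comm]
    exact add_le_add h1 h2

/-! ### Comparison of the two operators -/

lemma boundedWith_sublinear_iff {v : ℂ → ℝ} (hv : MemDHat v) (hI : IntegrabilityCondition v)
    {C : ℝ≥0} : BoundedWith v sublinearHilbertOp C ↔ BoundedWith v hilbertOp C := by
  constructor
  · intro h φ hφ
    have hint := integrableOn_of_memLp hv hI hφ
    have hle := dirichletNorm_hilbertOp_le hv.1 hint
    exact ⟨⟨differentiableOn_hilbertOp hint, hle.trans_lt (h φ hφ).1.2⟩, hle.trans (h φ hφ).2⟩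
  · intro h φ hφ
    have := h (fun t ↦ (‖φ t‖ : ℂ)) hφ.norm.ofReal
    rw [← sublinearHilbertOp_eq] at this
    refine ⟨this.1, this.2.trans_eq ?_⟩
    congr 1
    exact eLpNorm_congr_norm_ae (Filter.Eventually.of_forall fun t ↦ by simp)

lemma opNorm_sublinear_eq {v : ℂ → ℝ} (hv : MemDHat v) (hI : IntegrabilityCondition v) :
    opNorm v sublinearHilbertOp = opNorm v hilbertOp := by
  simp only [opNorm, boundedWith_sublinear_iff hv hI]

lemma exists_boundedWith_sublinear (K m : ℝ≥0) (hm : 0 < m) :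
    ∃ C : ℝ≥0, 0 < C ∧ ∀ v : ℂ → ℝ, MemDHat v → IntegrabilityCondition v → M₁ v < ∞ → M₂ v < ∞ →
      DoublingWith v K → m ≤ vhat v 0 →
        BoundedWith v sublinearHilbertOp (C * (M₁ v * M₂ v)).toNNReal := by
  obtain ⟨C, hC, h⟩ := dirichletNorm_sublinearHilbertOp_le K m hm
  refine ⟨C, hC, fun v hv hI h₁ h₂ hK hmv φ hφ ↦ ?_⟩
  have hle := h v hv hI h₁ h₂ hK hmv φ hφ
  have hint := integrableOn_of_memLp hv hI hφ
  rw [ENNReal.coe_toNNReal (by finiteness)]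
  refine ⟨⟨?_, hle.trans_lt (ENNReal.mul_lt_top (by finiteness) hφ.2)⟩, hle⟩
  rw [sublinearHilbertOp_eq]
  exact differentiableOn_hilbertOp hint.norm.ofReal

end

end WeightedDirichlet

open WeightedDirichlet in
theorem theorem2 :
    (∀ v : ℂ → ℝ, MemDHat v → IntegrabilityCondition v → M₁ v < ∞ →
      [IsBoundedOp v hilbertOp, IsBoundedOp v sublinearHilbertOp, M₂ v < ∞].TFAE) ∧
    (∃ C : ℝ≥0, 0 < C ∧
      ∀ v : ℂ → ℝ, MemDHat v → IntegrabilityCondition v → M₁ v < ∞ → M₂ v < ∞ →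
        M₂ v / M₁ v ≤ C * opNorm v hilbertOp ∧
        opNorm v hilbertOp ≤ C * opNorm v sublinearHilbertOp ∧
        opNorm v sublinearHilbertOp ≤ C * opNorm v hilbertOp) ∧
    (∀ K m : ℝ≥0, 0 < m → ∃ C : ℝ≥0, 0 < C ∧
      ∀ v : ℂ → ℝ, MemDHat v → IntegrabilityCondition v → M₁ v < ∞ → M₂ v < ∞ →
        DoublingWith v K → m ≤ vhat v 0 →
        opNorm v sublinearHilbertOp ≤ C * (M₁ v * M₂ v)) := by
  refine ⟨fun v hv hI h₁ ↦ ?_, ⟨257, by norm_num, fun v hv hI h₁ h₂ ↦ ⟨?_, ?_, ?_⟩⟩,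
    fun K m hm ↦ ?_⟩
  · have h12 : IsBoundedOp v sublinearHilbertOp ↔ IsBoundedOp v hilbertOp :=
      exists_congr fun C ↦ boundedWith_sublinear_iff hv hI
    tfae_have 1 ↔ 2 := h12.symm
    tfae_have 1 → 3 := fun ⟨C, hC⟩ ↦
      (M₂_le_of_boundedWith hv hI hC).trans_lt (by finiteness)
    tfae_have 3 → 2 := by
      intro h₂
      obtain ⟨K, hK⟩ := hv.2
      have h0 := vhat_ne_zero hv.1 le_rfl zero_lt_one
      have ht := vhat_ne_top hv le_rfl
      obtain ⟨C, -, hC⟩ := exists_boundedWith_sublinear K (vhat v 0).toNNReal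
        (ENNReal.toNNReal_pos h0 ht)
      exact ⟨_, hC v hv hI h₁ h₂ hK (ENNReal.coe_toNNReal ht).le⟩
    tfae_finish
  · rw [mul_comm, ← ENNReal.div_le_iff_le_mul (Or.inl (by simp)) (Or.inl (by simp))]
    refine le_iInf₂ fun C hC ↦ ?_
    rw [ENNReal.div_le_iff_le_mul (Or.inl (by simp)) (Or.inl (by simp))]
    refine ENNReal.div_le_of_le_mul ((M₂_le_of_boundedWith hv hI hC).trans_eq ?_)
    push_cast
    ring
  · rw [opNorm_sublinear_eq hv hI]
    exact le_mul_of_one_le_left' (by norm_num)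
  · rw [opNorm_sublinear_eq hv hI]
    exact le_mul_of_one_le_left' (by norm_num)
  · obtain ⟨C, hC, h⟩ := exists_boundedWith_sublinear K m hm
    refine ⟨C, hC, fun v hv hI h₁ h₂ hK hmv ↦ ?_⟩
    refine (iInf₂_le _ (h v hv hI h₁ h₂ hK hmv)).trans ?_
    rw [ENNReal.coe_toNNReal (by finiteness)]
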